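/- Let $\gamma=(\gamma_1,\gamma_2)\in\mathbb C^2$ with ${\rm Im}(\gamma_1-\gamma_2)>1$, and let $s\in\mathbb C$ with ${\rm Re}(s-\imath\gamma_j)>1$ for $j=1,2$. Let $\mathcal V_\gamma$ be the space of functions $f$ on $GL_2(\mathbb R)$ with $f(bg)=|b_{11}|^{\imath\gamma_1-\frac12}|b_{22}|^{\imath\gamma_2+\frac12}f(g)$ for all lower triangular $b$, with the action $(\pi_\gamma(g)f)(x)=f(xg)$ of $GL_2(\mathbb R)$. Let $\phi_{O_2}\in\mathcal V_\gamma$ be its $O_2$-invariant vector with $\phi_{O_2}\left(\begin{smallmatrix}1&x\\0&1\end{smallmatrix}\right)=(1+x^2)^{\frac{\imath(\gamma_1-\gamma_2)-1}{2}}$. Let $\mathcal P$ be the set of pairs $(n,m)\in\mathbb Z^2$ with $\gcd(n,m)=1$, modulo $(n,m)\sim(-n,-m)$, and let $\langle\phi_{GL_2(\mathbb Z)},f\rangle=\sum_{(n,m)\in\mathcal P}f(\delta_{n,m})$, where $\delta_{n,m}\in SL_2(\mathbb Z)$ has first row $(n,m)$ (the summand does not depend on the choice of $\delta_{n,m}$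 or of the sign). The Eisenstein function is $\Phi_\gamma(g)=\langle\phi_{GL_2(\mathbb Z)},\pi_\gamma(g)\phi_{O_2}\rangle$ for $g\in GL_2(\mathbb R)$. Let $d\mu(h)=\pi^{-1}|\det h|^{-2}\prod_{i,j}dh_{ij}$, a Haar measure of $GL_2(\mathbb R)$. The global Hecke-Baxter operator is $$\bigl(\widehat Q^{GL_2}_s\bullet\Phi\bigr)(g)=\int_{GL_2(\mathbb R)}d\mu(h)\,\widehat Q^{GL_2}_s(g,h)\,\Phi(h^{-1}),$$ $$\widehat Q^{GL_2}_s(g,h)=|\det g|^{s+\frac12}\sum_{\alpha}|\det h|^{s+\frac12}\,e^{-\pi{\rm Tr}(h^\top h\,\alpha gg^\top\alpha^\top)},$$ where $\alpha$ runs over the representatives $\left(\begin{smallmatrix}a&b\\0&d\end{smallmatrix}\right)$, $a,b,d\in\mathbb Z$, $a,d>0$, $0\le b<d$, of $SL_2(\mathbb Z)\backslash{\rm Mat}^*_2(\mathbb Z)$, ${\rm Mat}_2^*(\mathbb Z)$ being the set of integer $2\times2$ matrices with positive determinant. Then for every $g=\left(\begin{smallmatrix}a&b\\c&d\end{smallmatrix}\right)\in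 GL_2(\mathbb R)$ the series $$\Phi_\gamma(g)=|\det g|^{\imath\gamma_2+\frac12}\sum_{(n,m)\in\mathcal P}\bigl((na+mc)^2+(nb+md)^2\bigr)^{\frac{\imath(\gamma_1-\gamma_2)-1}{2}}$$ converges absolutely, the series that defines $\widehat Q^{GL_2}_s(g,h)$ converges for every $h\in GL_2(\mathbb R)$, the function $h\mapsto\widehat Q^{GL_2}_s(g,h)\,\Phi_\gamma(h^{-1})$ is integrable with respect to $\mu$, and $$\bigl(\widehat Q^{GL_2}_s\bullet\Phi_\gamma\bigr)(g)=\left(\prod_{j=1}^2\pi^{-\frac{s-\imath\gamma_j}{2}}\,\Gamma\Bigl(\frac{s-\imath\gamma_j}{2}\Bigr)\,\zeta(s-\imath\gamma_j)\right)\Phi_\gamma(g).$$ -/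

import Mathlib

open MeasureTheory

namespace HeckeBaxter

noncomputable section

/-- The four entries of an invertible matrix. -/
def entries (h : GL (Fin 2) ℝ) : Fin 2 → Fin 2 → ℝ := fun i j => h i j

/-- The Borel sets of `GL₂(ℝ)`, as an open subset of the space of matrices. -/
instance measurableSpaceGL : MeasurableSpace (GL (Fin 2) ℝ) :=
  MeasurableSpace.comap entries inferInstance

theorem measurableEmbedding_entries : MeasurableEmbedding entries := by
  have hr : Set.range entries =
      {A : Fin 2 → Fin 2 → ℝ | A 0 0 * A 1 1 - A 0 1 * A 1 0 ≠ 0} := by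
    ext A
    constructor
    · rintro ⟨h, rfl⟩
      have h0 : h.val.det ≠ 0 := ((Matrix.isUnit_iff_isUnit_det _).1 h.isUnit).ne_zero
      rwa [Matrix.det_fin_two] at h0
    · intro hA
      have h0 : (Matrix.of A).det ≠ 0 := by rw [Matrix.det_fin_two]; exact hA
      exact ⟨Matrix.GeneralLinearGroup.mkOfDetNeZero (Matrix.of A) h0, rfl⟩
  refine MeasurableEmbedding.iff_comap_eq.2 ⟨?_, rfl, ?_⟩
  · intro h k hk
    ext i j
    exact congrFun (congrFun hk i) j
  · rw [hr]
    have hm : Measurable fun A : Fin 2 → Fin 2 → ℝ => A 0 0 * A 1 1 - A 0 1 * A 1 0 := by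
      fun_prop
    exact hm (measurableSet_singleton 0).compl

/-- The Haar measure of `GL₂(ℝ)`, `dμ(h) = π⁻¹ |det h|⁻² dh₁₁ dh₁₂ dh₂₁ dh₂₂`.
With this normalization, the decomposition `h = k (a₁ 0; a₁c a₂)` with `k` orthogonal,
`a₁, a₂ ∈ ℝ*`, `c ∈ ℝ`, carries the product of the probability Haar measure of `O₂` with
`da₁/|a₁| · da₂/|a₂| · dc` to it. -/
def haarGL : Measure (GL (Fin 2) ℝ) :=
  (Measure.comap entries volume).withDensity
    fun h => ENNReal.ofReal (Real.pi⁻¹ * (|h.val.det| ^ 2)⁻¹)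

/-- The spherical character `χ_γ(b) = |b₁₁|^{iγ₁ - 1/2} |b₂₂|^{iγ₂ + 1/2}`
of the lower triangular subgroup. -/
def borelCharacter (γ : Fin 2 → ℂ) (b : GL (Fin 2) ℝ) : ℂ :=
  ((|b 0 0| : ℝ) : ℂ) ^ (Complex.I * γ 0 - 1 / 2) * ((|b 1 1| : ℝ) : ℂ) ^ (Complex.I * γ 1 + 1 / 2)

/-- The space of functions `f` on `GL₂(ℝ)` with `f(bg) = χ_γ(b) f(g)` for lower triangular `b`. -/
def principalSeries (γ : Fin 2 → ℂ) : Submodule ℂ (GL (Fin 2) ℝ → ℂ) where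
  carrier := {f | ∀ b g : GL (Fin 2) ℝ, b 0 1 = 0 → f (b * g) = borelCharacter γ b * f g}
  zero_mem' := by intro b g _; simp
  add_mem' := by
    intro f₁ f₂ h₁ h₂ b g hb
    simp only [Pi.add_apply, h₁ b g hb, h₂ b g hb, mul_add]
  smul_mem' := by
    intro c f h b g hb
    simp only [Pi.smul_apply, smul_eq_mul, h b g hb, mul_left_comm]

/-- The action `(π_γ(g) f)(x) = f(x g)`. -/
def principalSeriesRep (γ : Fin 2 → ℂ) : Representation ℂ (GL (Fin 2) ℝ) (principalSeries γ) where
  toFun g :=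
    { toFun := fun f => ⟨fun x => f.val (x * g), fun b x hb => by
        simpa only [mul_assoc] using f.property b (x * g) hb⟩
      map_add' := fun _ _ => rfl
      map_smul' := fun _ _ => rfl }
  map_one' := by ext f x; simp
  map_mul' g₁ g₂ := by ext f x; simp [mul_assoc]

theorem row_sq_pos (k : GL (Fin 2) ℝ) : 0 < k 0 0 ^ 2 + k 0 1 ^ 2 := by
  have h0 : k.val.det ≠ 0 := ((Matrix.isUnit_iff_isUnit_det _).1 k.isUnit).ne_zero
  rw [Matrix.det_fin_two] at h0
  by_contra h
  have h1 : k 0 0 = 0 := by nlinarith [sq_nonneg (k 0 0), sq_nonneg (k 0 1)]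
  have h2 : k 0 1 = 0 := by nlinarith [sq_nonneg (k 0 0), sq_nonneg (k 0 1)]
  apply h0
  simp [h1, h2]

/-- The function
`|det k|^{iγ₂ + 1/2} (k₁₁² + k₁₂²)^{(i(γ₁ - γ₂) - 1)/2}` on `GL₂(ℝ)`. -/
def sphericalFun (γ : Fin 2 → ℂ) (k : GL (Fin 2) ℝ) : ℂ :=
  ((|k.val.det| : ℝ) : ℂ) ^ (Complex.I * γ 1 + 1 / 2) *
    ((k 0 0 ^ 2 + k 0 1 ^ 2 : ℝ) : ℂ) ^ ((Complex.I * (γ 0 - γ 1) - 1) / 2)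

theorem sphericalFun_mem (γ : Fin 2 → ℂ) : sphericalFun γ ∈ principalSeries γ := by
  intro b g hb
  have hd : b.val.det ≠ 0 := ((Matrix.isUnit_iff_isUnit_det _).1 b.isUnit).ne_zero
  rw [Matrix.det_fin_two, hb, zero_mul, sub_zero] at hd
  have hb0 : b 0 0 ≠ 0 := left_ne_zero_of_mul hd
  have e1 : |(b * g).val.det| = |b 0 0| * |b 1 1| * |g.val.det| := by
    rw [Matrix.GeneralLinearGroup.coe_mul, Matrix.det_mul, abs_mul, Matrix.det_fin_two b.val, hb,
      zero_mul, sub_zero, abs_mul]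
  have e2 : (b * g) 0 0 ^ 2 + (b * g) 0 1 ^ 2 = |b 0 0| ^ 2 * (g 0 0 ^ 2 + g 0 1 ^ 2) := by
    rw [Matrix.GeneralLinearGroup.coe_mul, Matrix.mul_apply, Matrix.mul_apply, Fin.sum_univ_two,
      Fin.sum_univ_two, hb, sq_abs]
    ring
  have e3 : ((|b 0 0| ^ 2 : ℝ) : ℂ) ^ ((Complex.I * (γ 0 - γ 1) - 1) / 2) =
      ((|b 0 0| : ℝ) : ℂ) ^ (Complex.I * (γ 0 - γ 1) - 1) := by
    rw [Complex.ofReal_pow, ← Complex.cpow_nat_mul']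
    · congr 1
      push_cast
      ring
    · rw [Complex.arg_ofReal_of_nonneg (abs_nonneg _)]
      simpa using Real.pi_pos
    · rw [Complex.arg_ofReal_of_nonneg (abs_nonneg _)]
      simpa using Real.pi_pos.le
  have e4 : ((|b 0 0| : ℝ) : ℂ) ^ (Complex.I * γ 0 - 1 / 2) =
      ((|b 0 0| : ℝ) : ℂ) ^ (Complex.I * (γ 0 - γ 1) - 1) *
        ((|b 0 0| : ℝ) : ℂ) ^ (Complex.I * γ 1 + 1 / 2) := by
    rw [← Complex.cpow_add _ _ (by simpa using hb0)]
    congr 1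
    ring
  simp only [sphericalFun, borelCharacter]
  rw [e1, e2, e4, Complex.ofReal_mul (|b 0 0| ^ 2),
    Complex.mul_cpow_ofReal_nonneg (by positivity) (by positivity), e3, Complex.ofReal_mul,
    Complex.mul_cpow_ofReal_nonneg (by positivity) (by positivity), Complex.ofReal_mul,
    Complex.mul_cpow_ofReal_nonneg (by positivity) (by positivity)]
  ring

/-- The `O₂`-invariant vector `φ_{O₂}`, whose restriction to the matrices `(1 x; 0 1)` is
`(1 + x²)^{(i(γ₁ - γ₂) - 1)/2}`. -/
def sphericalVector (γ : Fin 2 → ℂ) : principalSeries γ :=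
  ⟨sphericalFun γ, sphericalFun_mem γ⟩

theorem sphericalVector_unipotent (γ : Fin 2 → ℂ) (k : GL (Fin 2) ℝ) (x : ℝ)
    (hk : k.val = !![1, x; 0, 1]) :
    (sphericalVector γ).val k =
      ((1 + x ^ 2 : ℝ) : ℂ) ^ ((Complex.I * (γ 0 - γ 1) - 1) / 2) := by
  simp [sphericalVector, sphericalFun, hk, Matrix.det_fin_two_of]

theorem sphericalVector_invariant (γ : Fin 2 → ℂ) (k : GL (Fin 2) ℝ)
    (hk : k.val * k.val.transpose = 1) :
    principalSeriesRep γ k (sphericalVector γ) = sphericalVector γ := by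
  have hd : |k.val.det| = 1 := by
    have h := congrArg Matrix.det hk
    rw [Matrix.det_mul, Matrix.det_transpose, Matrix.det_one, ← sq] at h
    rw [← sq_abs] at h
    nlinarith [abs_nonneg k.val.det]
  have h00 := congrFun (congrFun hk 0) 0
  have h01 := congrFun (congrFun hk 0) 1
  have h11 := congrFun (congrFun hk 1) 1
  simp only [Matrix.mul_apply, Fin.sum_univ_two, Matrix.transpose_apply, Matrix.one_apply_eq,
    ne_eq, zero_ne_one, not_false_eq_true, Matrix.one_apply_ne] at h00 h01 h11
  ext x
  change sphericalFun γ (x * k) = sphericalFun γ x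
  have e1 : |(x * k).val.det| = |x.val.det| := by
    rw [Matrix.GeneralLinearGroup.coe_mul, Matrix.det_mul, abs_mul, hd, mul_one]
  have e2 : (x * k) 0 0 ^ 2 + (x * k) 0 1 ^ 2 = x 0 0 ^ 2 + x 0 1 ^ 2 := by
    rw [Matrix.GeneralLinearGroup.coe_mul, Matrix.mul_apply, Matrix.mul_apply, Fin.sum_univ_two,
      Fin.sum_univ_two]
    linear_combination (x 0 0) ^ 2 * h00 + 2 * x 0 0 * x 0 1 * h01 + (x 0 1) ^ 2 * h11
  simp only [sphericalFun, e1, e2]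

/-- Primitive integer vectors modulo sign, each given by its representative that is positive for
the lexicographic order. -/
def PrimitivePair : Type :=
  {p : ℤ × ℤ // IsCoprime p.1 p.2 ∧ (0 < p.1 ∨ p.1 = 0 ∧ 0 < p.2)}

/-- An integer matrix of determinant one with a prescribed primitive first row. -/
def primitiveMatrix (p : PrimitivePair) : Matrix.SpecialLinearGroup (Fin 2) ℤ :=
  ⟨!![p.val.1, p.val.2; -Int.gcdB p.val.1 p.val.2, Int.gcdA p.val.1 p.val.2], by
    have h : (Int.gcd p.val.1 p.val.2 : ℤ) = 1 := by
      exact_mod_cast Int.isCoprime_iff_gcd_eq_one.1 p.property.1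
    rw [Matrix.det_fin_two_of]
    linarith [Int.gcd_eq_gcd_ab p.val.1 p.val.2]⟩

theorem primitiveMatrix_row (p : PrimitivePair) :
    (Matrix.SpecialLinearGroup.mapGL ℝ (primitiveMatrix p)) 0 0 = (p.val.1 : ℝ) ∧
    (Matrix.SpecialLinearGroup.mapGL ℝ (primitiveMatrix p)) 0 1 = (p.val.2 : ℝ) ∧
    (Matrix.SpecialLinearGroup.mapGL ℝ (primitiveMatrix p)).val.det = 1 := by
  refine ⟨rfl, rfl, ?_⟩
  rw [Matrix.SpecialLinearGroup.mapGL_coe_matrix]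
  exact Matrix.SpecialLinearGroup.det_coe _

/-- The pairing with the `GL₂(ℤ)`-invariant generalized vector
`φ_{GL₂(ℤ)}(x) = ∑ |n|^{-i(γ₁ - γ₂)} δ(m + n x)`. The term of `(n, m)` takes `f` to
`|n|^{i(γ₁ - γ₂) - 1} f(1 x; 0 1)` with `x = -m/n`, which is the value of `f` at any integer matrix of
determinant one with first row `(n, -m)`; this also gives a meaning to the term with `n = 0`, at
infinity. The sum is written with `m` in place of `-m`. -/
def integralPairing (γ : Fin 2 → ℂ) (f : principalSeries γ) : ℂ :=
  ∑' p : PrimitivePair, f.val (Matrix.SpecialLinearGroup.mapGL ℝ (primitiveMatrix p))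

/-- The value of a vector of the principal series at an integer matrix of determinant one with
first row `(n, m)`, `n ≠ 0`, through its restriction to the matrices `(1 x; 0 1)`. -/
theorem value_primitiveMatrix (γ : Fin 2 → ℂ) (f : principalSeries γ) (p : PrimitivePair)
    (hp : p.val.1 ≠ 0) (k : GL (Fin 2) ℝ) (hk : k.val = !![1, (p.val.2 / p.val.1 : ℝ); 0, 1]) :
    f.val (Matrix.SpecialLinearGroup.mapGL ℝ (primitiveMatrix p)) =
      ((|(p.val.1 : ℝ)| : ℝ) : ℂ) ^ (Complex.I * (γ 0 - γ 1) - 1) * f.val k := by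
  set n : ℤ := p.val.1 with hn
  set m : ℤ := p.val.2 with hm
  have hn' : (n : ℝ) ≠ 0 := by exact_mod_cast hp
  set K : GL (Fin 2) ℝ := Matrix.SpecialLinearGroup.mapGL ℝ (primitiveMatrix p) with hK
  have K00 : K 0 0 = n := (primitiveMatrix_row p).1
  have K01 : K 0 1 = m := (primitiveMatrix_row p).2.1
  have kd : k.val.det = 1 := by rw [hk]; simp [Matrix.det_fin_two_of]
  have Kd : K.val.det = 1 := (primitiveMatrix_row p).2.2
  have hk01 : k⁻¹ 0 1 = -(m / n : ℝ) := by
    rw [Matrix.GeneralLinearGroup.coe_inv, Matrix.inv_def, kd, hk, Matrix.adjugate_fin_two_of]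
    simp
  have hk00 : k⁻¹ 0 0 = 1 := by
    rw [Matrix.GeneralLinearGroup.coe_inv, Matrix.inv_def, kd, hk, Matrix.adjugate_fin_two_of]
    simp
  have hk11 : k⁻¹ 1 1 = 1 := by
    rw [Matrix.GeneralLinearGroup.coe_inv, Matrix.inv_def, kd, hk, Matrix.adjugate_fin_two_of]
    simp
  have hk10 : k⁻¹ 1 0 = 0 := by
    rw [Matrix.GeneralLinearGroup.coe_inv, Matrix.inv_def, kd, hk, Matrix.adjugate_fin_two_of]
    simp
  have b00 : (K * k⁻¹) 0 0 = n := by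
    rw [Matrix.GeneralLinearGroup.coe_mul, Matrix.mul_apply, Fin.sum_univ_two, hk00, hk10, K00]
    ring
  have b01 : (K * k⁻¹) 0 1 = 0 := by
    rw [Matrix.GeneralLinearGroup.coe_mul, Matrix.mul_apply, Fin.sum_univ_two, hk01, hk11, K00,
      K01]
    field_simp
    ring
  have bd : (K * k⁻¹).val.det = 1 := by
    rw [Matrix.GeneralLinearGroup.coe_mul, Matrix.det_mul, Kd, Matrix.GeneralLinearGroup.coe_inv,
      Matrix.det_nonsing_inv, kd]
    simp
  have b11 : (K * k⁻¹) 1 1 = (n : ℝ)⁻¹ := by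
    rw [Matrix.det_fin_two, b00, b01, zero_mul, sub_zero] at bd
    exact eq_inv_of_mul_eq_one_right bd
  have h := f.property (K * k⁻¹) k b01
  rw [inv_mul_cancel_right] at h
  rw [h, borelCharacter, b00, b11, abs_inv, Complex.ofReal_inv,
    Complex.inv_cpow _ _ (by
      rw [Complex.arg_ofReal_of_nonneg (abs_nonneg _)]; exact Real.pi_pos.ne),
    ← Complex.cpow_neg, ← Complex.cpow_add _ _ (by simpa using hp)]
  congr 2
  ring

/-- The Eisenstein function `Φ_γ(g) = ⟨φ_{GL₂(ℤ)}, π_γ(g) φ_{O₂}⟩`. -/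
def eisenstein (γ : Fin 2 → ℂ) (g : GL (Fin 2) ℝ) : ℂ :=
  integralPairing γ (principalSeriesRep γ g (sphericalVector γ))

/-- The summand of index `(n, m)` in the series of the Eisenstein function. -/
def eisensteinTerm (γ : Fin 2 → ℂ) (g : GL (Fin 2) ℝ) (p : PrimitivePair) : ℂ :=
  ((|g.val.det| : ℝ) : ℂ) ^ (Complex.I * γ 1 + 1 / 2) *
    ((((p.val.1 * g 0 0 + p.val.2 * g 1 0) ^ 2 + (p.val.1 * g 0 1 + p.val.2 * g 1 1) ^ 2 : ℝ)) : ℂ) ^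
      ((Complex.I * (γ 0 - γ 1) - 1) / 2)

theorem eisenstein_eq_tsum (γ : Fin 2 → ℂ) (g : GL (Fin 2) ℝ) :
    eisenstein γ g = ∑' p : PrimitivePair, eisensteinTerm γ g p := by
  refine tsum_congr fun p => ?_
  change sphericalFun γ (Matrix.SpecialLinearGroup.mapGL ℝ (primitiveMatrix p) * g) = _
  set K : GL (Fin 2) ℝ := Matrix.SpecialLinearGroup.mapGL ℝ (primitiveMatrix p) with hK
  have K00 : K 0 0 = p.val.1 := (primitiveMatrix_row p).1
  have K01 : K 0 1 = p.val.2 := (primitiveMatrix_row p).2.1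
  have Kd : K.val.det = 1 := (primitiveMatrix_row p).2.2
  simp only [sphericalFun, eisensteinTerm]
  rw [Matrix.GeneralLinearGroup.coe_mul, Matrix.det_mul, Kd, one_mul, Matrix.mul_apply,
    Matrix.mul_apply, Fin.sum_univ_two, Fin.sum_univ_two, K00, K01]

/-- The representatives `(a b; 0 d)`, `a, d > 0`, `0 ≤ b < d`, of the cosets of `SL₂(ℤ)` (acting on
the left) in the set of integer matrices with positive determinant. -/
def HeckeRep : Type :=
  {α : Matrix (Fin 2) (Fin 2) ℤ //
    0 < α 0 0 ∧ 0 < α 1 1 ∧ α 1 0 = 0 ∧ 0 ≤ α 0 1 ∧ α 0 1 < α 1 1}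

/-- The Gaussian summand `exp(-π Tr(hᵀ h α g gᵀ αᵀ))`. -/
def heckeGaussian (g h : GL (Fin 2) ℝ) (α : HeckeRep) : ℝ :=
  Real.exp (-Real.pi * Matrix.trace
    (h.val.transpose * h.val * (α.val.map (Int.cast : ℤ → ℝ) * g.val * g.val.transpose *
      (α.val.map (Int.cast : ℤ → ℝ)).transpose)))

/-- The kernel of the global Hecke-Baxter operator. -/
def kernel (s : ℂ) (g h : GL (Fin 2) ℝ) : ℂ :=
  ((|g.val.det| : ℝ) : ℂ) ^ (s + 1 / 2) *
    ∑' α : HeckeRep, ((|h.val.det| : ℝ) : ℂ) ^ (s + 1 / 2) * (heckeGaussian g h α : ℂ)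

/-- The global Hecke-Baxter operator. -/
def heckeBaxter (s : ℂ) (Φ : GL (Fin 2) ℝ → ℂ) (g : GL (Fin 2) ℝ) : ℂ :=
  ∫ h, kernel s g h * Φ h⁻¹ ∂haarGL

/-- The completed global `L`-factor. -/
def completedZeta (s : ℂ) (γ : Fin 2 → ℂ) : ℂ :=
  ∏ j, ((Real.pi : ℂ) ^ (-(s - Complex.I * γ j) / 2) *
    Complex.Gamma ((s - Complex.I * γ j) / 2) * riemannZeta (s - Complex.I * γ j))

end

end HeckeBaxter

open MeasureTheory

namespace HeckeBaxter

noncomputable section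

/-! Write z₁, z₂ for the two numbers s - iγ_j, φ for `sphericalFun γ`, δ_p for `primitiveMatrix p`,
and K(h) = |det h|^{s+1/2} exp(-π Tr(hᵀh)). When both series are expanded, the integrand is the sum
over pairs (p, α) of |det α|^{-(s+1/2)} K(hαg) φ(δ_p h⁻¹) (`kernelTerm_eq`). Right translation of h
by αg replaces φ(δ_p h⁻¹) by φ(δ_p αg h⁻¹), and the problem splits into an archimedean and an
arithmetic half.

Archimedean half (`integrable_and_integral_localKernel`): φ is an eigenfunction of K, that is, ∫
K(h) φ(xh⁻¹) dμ = Γ_ℝ(z₁) Γ_ℝ(z₂) φ(x). The decomposition of x as lower triangular times rotation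
reduces this to x = 1. There the integrand, in the columns u, v of h, is a Gaussian times |det(u,
v)|^{z₁-1} |v|^{z₂-z₁-1}; a rotation of u and polar coordinates in v produce the two Gamma factors.

Arithmetic half (`hasSum_heckeTerm`): the sum of |det α|^{-(s+1/2)} φ(δ_p αg) over (p, α) is ζ(z₁)
ζ(z₂) Φ(g). Every coset of the lower triangular subgroup of SL₂(ℤ) in the integer matrices of
positive determinant has exactly one representative δ_p α and exactly one representative βδ_q with β
= (k 0; c l), 0 ≤ c < k (`cosetEquiv`). The summand depends only on the coset, and φ(βδ_q g) is
φ(δ_q g) times the character of β. So the sum factors as Φ(g) times ∑ k · k^{-z₁-1} l^{-z₂}, where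
the factor k counts the residues c.

Exchange of sum and integral needs no new estimate: the absolute value of each term is the term for
real exponents (`absParam`), so the same two formulas show that the L¹ norms are summable. -/

/-! ### Complex powers and Gaussian integrals on the line -/

theorem ofReal_rpow_cpow {x : ℝ} (hx : 0 < x) (a : ℝ) (b : ℂ) :
    ((x ^ a : ℝ) : ℂ) ^ b = (x : ℂ) ^ (a * b) := by
  have hxc : (x : ℂ) ≠ 0 := by exact_mod_cast hx.ne'
  have hxa : ((x ^ a : ℝ) : ℂ) ≠ 0 := by exact_mod_cast (Real.rpow_pos_of_pos hx a).ne'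
  rw [Complex.cpow_def_of_ne_zero hxc, Complex.cpow_def_of_ne_zero hxa, ← Complex.ofReal_log hx.le,
    ← Complex.ofReal_log (Real.rpow_pos_of_pos hx a).le, Real.log_rpow hx]
  congr 1
  push_cast
  ring

theorem ofReal_sq_cpow {x : ℝ} (hx : 0 < x) (b : ℂ) :
    ((x ^ 2 : ℝ) : ℂ) ^ b = (x : ℂ) ^ (2 * b) := by
  rw [← Real.rpow_two, ofReal_rpow_cpow hx]
  norm_num

/-- The substitution y = x² in the Gamma integral at z/2. -/
theorem integral_Ioi_cpow_mul_gaussian {z : ℂ} (hz : 0 < z.re) :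
    ∫ x in Set.Ioi (0 : ℝ), (x : ℂ) ^ (z - 1) * (Real.exp (-Real.pi * x ^ 2) : ℂ) =
      Complex.Gammaℝ z / 2 := by
  have h := integral_comp_rpow_Ioi_of_pos
    (g := fun y : ℝ => (y : ℂ) ^ (z / 2 - 1) * Complex.exp (-(Real.pi * y))) (p := 2) two_pos
  have h2 := Complex.integral_cpow_mul_exp_neg_mul_Ioi (a := z / 2) (r := Real.pi)
    (by simpa using hz) Real.pi_pos
  rw [h2] at h
  have e : ∀ x ∈ Set.Ioi (0 : ℝ), ((2 : ℝ) * x ^ ((2 : ℝ) - 1)) •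
      (((x ^ (2 : ℝ) : ℝ) : ℂ) ^ (z / 2 - 1) * Complex.exp (-(Real.pi * ((x ^ (2 : ℝ) : ℝ) : ℂ)))) =
      2 * ((x : ℂ) ^ (z - 1) * (Real.exp (-Real.pi * x ^ 2) : ℂ)) := by
    intro x hx
    have hx0 : (0 : ℝ) < x := hx
    have hxc : (x : ℂ) ≠ 0 := by exact_mod_cast hx0.ne'
    have e1 : z - 1 = 1 + (((2 : ℝ) : ℂ) * (z / 2 - 1)) := by push_cast; ring
    rw [ofReal_rpow_cpow hx0, e1, Complex.cpow_add _ _ hxc, Complex.cpow_one, Complex.real_smul]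
    norm_num
    ring
  rw [setIntegral_congr_fun measurableSet_Ioi e, integral_const_mul] at h
  rw [eq_div_iff two_ne_zero, mul_comm, h, Complex.Gammaℝ_def, one_div,
    Complex.inv_cpow _ _ (by
      rw [Complex.arg_ofReal_of_nonneg Real.pi_pos.le]; exact Real.pi_pos.ne),
    ← Complex.cpow_neg, neg_div]

/-- Equality can fail only at x = 0: for purely imaginary b ≠ 0 the left side is 0 and the right
side is 1. -/
theorem norm_ofReal_cpow_le {x : ℝ} (hx : 0 ≤ x) (b : ℂ) :
    ‖(x : ℂ) ^ b‖ ≤ ‖(x : ℂ) ^ (b.re : ℂ)‖ := by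
  rcases hx.eq_or_lt with rfl | h
  · by_cases hb : b = 0
    · simp [hb]
    · simpa [Complex.zero_cpow hb] using Real.zero_rpow_nonneg _
  · rw [Complex.norm_cpow_eq_rpow_re_of_pos h, Complex.norm_cpow_eq_rpow_re_of_pos h,
      Complex.ofReal_re]

theorem measurable_ofReal_cpow (b : ℂ) : Measurable fun x : ℝ => (x : ℂ) ^ b :=
  (Complex.measurable_ofReal).pow_const b

theorem Gammaℝ_ofReal_ne_zero {r : ℝ} (hr : 0 < r) : Complex.Gammaℝ (r : ℂ) ≠ 0 :=
  Complex.Gammaℝ_ne_zero_of_re_pos (by simpa using hr)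

/-- A function that is not integrable has Bochner integral 0, so the nonzero value Γ_ℝ(Re z)/2
already proves integrability for a real exponent. A complex exponent is dominated by its real part.
-/
theorem integrableOn_Ioi_cpow_mul_gaussian {z : ℂ} (hz : 0 < z.re) :
    IntegrableOn (fun x : ℝ => (x : ℂ) ^ (z - 1) * (Real.exp (-Real.pi * x ^ 2) : ℂ))
      (Set.Ioi 0) := by
  have h : IntegrableOn (fun x : ℝ => (x : ℂ) ^ ((z.re : ℂ) - 1) *
      (Real.exp (-Real.pi * x ^ 2) : ℂ)) (Set.Ioi 0) := by
    apply Integrable.of_integral_ne_zero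
    rw [integral_Ioi_cpow_mul_gaussian (by simpa using hz)]
    exact div_ne_zero (Gammaℝ_ofReal_ne_zero hz) two_ne_zero
  have hm : Measurable fun x : ℝ => (Real.exp (-Real.pi * x ^ 2) : ℂ) := by fun_prop
  refine Integrable.mono h (((measurable_ofReal_cpow _).mul hm).aestronglyMeasurable) ?_
  filter_upwards [ae_restrict_mem measurableSet_Ioi] with x hx
  rw [norm_mul, norm_mul]
  gcongr
  simpa using norm_ofReal_cpow_le (le_of_lt hx) (z - 1)

theorem integrable_and_integral_abs_cpow_mul_gaussian {z : ℂ} (hz : 0 < z.re) :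
    Integrable (fun x : ℝ => ((|x| : ℝ) : ℂ) ^ (z - 1) * (Real.exp (-Real.pi * x ^ 2) : ℂ)) ∧
    ∫ x : ℝ, ((|x| : ℝ) : ℂ) ^ (z - 1) * (Real.exp (-Real.pi * x ^ 2) : ℂ) =
      Complex.Gammaℝ z := by
  set f : ℝ → ℂ := fun x => ((|x| : ℝ) : ℂ) ^ (z - 1) * (Real.exp (-Real.pi * x ^ 2) : ℂ) with hf
  have hneg : ∀ x, f (-x) = f x := fun x => by simp [hf]
  have hpos : Set.EqOn (fun x : ℝ => (x : ℂ) ^ (z - 1) * (Real.exp (-Real.pi * x ^ 2) : ℂ)) f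
      (Set.Ioi 0) := fun x hx => by
    have hx0 : (0 : ℝ) < x := hx
    simp only [hf, abs_of_pos hx0]
  have i1 : IntegrableOn f (Set.Ioi 0) :=
    (integrableOn_Ioi_cpow_mul_gaussian hz).congr_fun hpos measurableSet_Ioi
  have v1 : ∫ x in Set.Ioi 0, f x = Complex.Gammaℝ z / 2 := by
    rw [← integral_Ioi_cpow_mul_gaussian hz]
    exact (setIntegral_congr_fun measurableSet_Ioi hpos).symm
  have i2 : IntegrableOn f (Set.Iic 0) := by
    have h := ((integrableOn_Ici_iff_integrableOn_Ioi).2 i1).comp_neg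
    simpa [hneg] using h
  have v2 : ∫ x in Set.Iic 0, f x = Complex.Gammaℝ z / 2 := by
    rw [← v1]
    have h := integral_comp_neg_Ioi (0 : ℝ) f
    simpa [hneg] using h.symm
  refine ⟨?_, ?_⟩
  · have := i2.union i1
    rwa [Set.Iic_union_Ioi, integrableOn_univ] at this
  · rw [← intervalIntegral.integral_Iic_add_Ioi i2 i1, v1, v2]
    ring

theorem integral_gaussian_pi : ∫ x : ℝ, (Real.exp (-Real.pi * x ^ 2) : ℂ) = 1 := by
  rw [integral_complex_ofReal, integral_gaussian, div_self Real.pi_ne_zero]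
  simp

theorem integrable_gaussian_pi :
    Integrable fun x : ℝ => (Real.exp (-Real.pi * x ^ 2) : ℂ) :=
  (integrable_exp_neg_mul_sq Real.pi_pos).ofReal

/-! ### Gaussian integrals on the plane -/

/-- The square of the Euclidean norm of a vector of `ℝ²`. -/
def normSqVec (v : Fin 2 → ℝ) : ℝ := v 0 ^ 2 + v 1 ^ 2

/-- The determinant of two vectors of `ℝ²`. -/
def crossVec (u v : Fin 2 → ℝ) : ℝ := u 0 * v 1 - u 1 * v 0

theorem normSqVec_nonneg (v : Fin 2 → ℝ) : 0 ≤ normSqVec v := by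
  unfold normSqVec; positivity

theorem normSqVec_pos {v : Fin 2 → ℝ} (hv : v ≠ 0) : 0 < normSqVec v := by
  rcases (normSqVec_nonneg v).eq_or_lt with h | h
  · exfalso
    apply hv
    unfold normSqVec at h
    ext i
    fin_cases i
    · change v 0 = 0
      nlinarith [sq_nonneg (v 0), sq_nonneg (v 1)]
    · change v 1 = 0
      nlinarith [sq_nonneg (v 0), sq_nonneg (v 1)]
  · exact h

theorem integral_vec_eq_prod (f : (Fin 2 → ℝ) → ℂ) :
    ∫ v, f v = ∫ p : ℝ × ℝ, f ![p.1, p.2] :=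
  ((volume_preserving_finTwoArrow ℝ).symm.integral_comp' f).symm

theorem integrable_vec_iff_prod (f : (Fin 2 → ℝ) → ℂ) :
    Integrable f ↔ Integrable fun p : ℝ × ℝ => f ![p.1, p.2] :=
  ((volume_preserving_finTwoArrow ℝ).symm.integrable_comp_emb
    (MeasurableEquiv.measurableEmbedding _)).symm

theorem ofReal_exp_add (a b : ℝ) :
    (Real.exp (-Real.pi * (a + b)) : ℂ) =
      (Real.exp (-Real.pi * a) : ℂ) * (Real.exp (-Real.pi * b) : ℂ) := by
  rw [← Complex.ofReal_mul, ← Real.exp_add, mul_add]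

theorem integrable_and_integral_fst_cpow {z : ℂ} (hz : 0 < z.re) :
    Integrable (fun u : Fin 2 → ℝ => ((|u 0| : ℝ) : ℂ) ^ (z - 1) *
      (Real.exp (-Real.pi * normSqVec u) : ℂ)) ∧
    ∫ u : Fin 2 → ℝ, ((|u 0| : ℝ) : ℂ) ^ (z - 1) * (Real.exp (-Real.pi * normSqVec u) : ℂ) =
      Complex.Gammaℝ z := by
  obtain ⟨h1, h2⟩ := integrable_and_integral_abs_cpow_mul_gaussian hz
  have e : (fun p : ℝ × ℝ => ((|(![p.1, p.2] : Fin 2 → ℝ) 0| : ℝ) : ℂ) ^ (z - 1) *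
      (Real.exp (-Real.pi * normSqVec ![p.1, p.2]) : ℂ)) = fun p : ℝ × ℝ =>
      (((|p.1| : ℝ) : ℂ) ^ (z - 1) * (Real.exp (-Real.pi * p.1 ^ 2) : ℂ)) *
      (Real.exp (-Real.pi * p.2 ^ 2) : ℂ) := by
    funext p
    simp only [normSqVec, Matrix.cons_val_zero, Matrix.cons_val_one]
    rw [ofReal_exp_add, mul_assoc]
  rw [integrable_vec_iff_prod, integral_vec_eq_prod, e]
  exact ⟨h1.mul_prod integrable_gaussian_pi, by
    rw [Measure.volume_eq_prod, integral_prod_mul (fun x : ℝ => ((|x| : ℝ) : ℂ) ^ (z - 1) *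
      (Real.exp (-Real.pi * x ^ 2) : ℂ)) (fun x : ℝ => (Real.exp (-Real.pi * x ^ 2) : ℂ)),
      h2, integral_gaussian_pi, mul_one]⟩

theorem measurePreserving_mulVec {M : Matrix (Fin 2) (Fin 2) ℝ} (hM : |M.det| = 1) :
    MeasurePreserving (M.mulVec) (volume : Measure (Fin 2 → ℝ)) volume := by
  have h0 : M.det ≠ 0 := by
    intro h
    simp [h] at hM
  refine ⟨(Matrix.mulVecLin M).continuous_of_finiteDimensional.measurable, ?_⟩
  have h := Real.map_matrix_volume_pi_eq_smul_volume_pi h0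
  rw [abs_inv, hM, inv_one, ENNReal.ofReal_one, one_smul] at h
  exact h

theorem measurableEmbedding_mulVec {M : Matrix (Fin 2) (Fin 2) ℝ} (hM : M.det ≠ 0) :
    MeasurableEmbedding (M.mulVec) := by
  have hu : IsUnit M := (Matrix.isUnit_iff_isUnit_det M).2 (isUnit_iff_ne_zero.2 hM)
  exact ((Matrix.mulVecLin M).continuous_of_finiteDimensional).measurableEmbedding
    (Matrix.mulVec_injective_of_isUnit hu)

/-- The Gaussian is rotation invariant, so v may be turned onto a coordinate axis; the determinant
becomes |v| times one coordinate of u. -/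
theorem integrable_and_integral_crossVec_cpow {z : ℂ} (hz : 0 < z.re) {v : Fin 2 → ℝ}
    (hv : v ≠ 0) :
    Integrable (fun u : Fin 2 → ℝ => ((|crossVec u v| : ℝ) : ℂ) ^ (z - 1) *
      (Real.exp (-Real.pi * normSqVec u) : ℂ)) ∧
    ∫ u : Fin 2 → ℝ, ((|crossVec u v| : ℝ) : ℂ) ^ (z - 1) *
      (Real.exp (-Real.pi * normSqVec u) : ℂ) =
      ((normSqVec v : ℝ) : ℂ) ^ ((z - 1) / 2) * Complex.Gammaℝ z := by
  have hq := normSqVec_pos hv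
  set r := Real.sqrt (normSqVec v) with hr
  have hr0 : 0 < r := Real.sqrt_pos.2 hq
  have hrq : r ^ 2 = v 0 ^ 2 + v 1 ^ 2 := Real.sq_sqrt hq.le
  -- The rotation taking v to (0, r); the first coordinate of Mu is the determinant of (u, v)
  -- divided by r.
  set M : Matrix (Fin 2) (Fin 2) ℝ := !![v 1 / r, -v 0 / r; v 0 / r, v 1 / r] with hM
  have hdet : M.det = 1 := by
    rw [hM, Matrix.det_fin_two_of]
    field_simp
    linarith
  have hmp := measurePreserving_mulVec (M := M) (by rw [hdet, abs_one])
  have hme := measurableEmbedding_mulVec (M := M) (by rw [hdet]; exact one_ne_zero)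
  obtain ⟨h1, h2⟩ := integrable_and_integral_fst_cpow hz
  have e : ∀ u : Fin 2 → ℝ, ((|crossVec u v| : ℝ) : ℂ) ^ (z - 1) *
      (Real.exp (-Real.pi * normSqVec u) : ℂ) =
      ((normSqVec v : ℝ) : ℂ) ^ ((z - 1) / 2) * (((|M.mulVec u 0| : ℝ) : ℂ) ^ (z - 1) *
      (Real.exp (-Real.pi * normSqVec (M.mulVec u)) : ℂ)) := by
    intro u
    have a0 : M.mulVec u 0 = crossVec u v / r := by
      simp [hM, Matrix.mulVec, dotProduct, Fin.sum_univ_two, crossVec]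
      ring
    have a1 : M.mulVec u 1 = (v 0 * u 0 + v 1 * u 1) / r := by
      simp [hM, Matrix.mulVec, dotProduct, Fin.sum_univ_two]
      ring
    have a2 : normSqVec (M.mulVec u) = normSqVec u := by
      unfold normSqVec
      rw [a0, a1, crossVec]
      field_simp
      rw [hrq]
      ring
    have a3 : |crossVec u v| = r * |M.mulVec u 0| := by
      rw [a0, abs_div, abs_of_pos hr0]
      field_simp
    have a4 : ((normSqVec v : ℝ) : ℂ) ^ ((z - 1) / 2) = (r : ℂ) ^ (z - 1) := by
      have : normSqVec v = r ^ 2 := by rw [hrq]; rfl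
      rw [this, ofReal_sq_cpow hr0]
      congr 1
      ring
    rw [a2, a3, a4, Complex.ofReal_mul, Complex.mul_cpow_ofReal_nonneg hr0.le (abs_nonneg _),
      mul_assoc]
  simp only [e]
  refine ⟨?_, ?_⟩
  · exact ((hmp.integrable_comp_emb hme).2 h1).const_mul _
  · rw [integral_const_mul]
    congr 1
    rw [← h2]
    exact hmp.integral_comp hme (fun u : Fin 2 → ℝ => ((|u 0| : ℝ) : ℂ) ^ (z - 1) *
      (Real.exp (-Real.pi * normSqVec u) : ℂ))

/-- Polar coordinates: the angle contributes 2π and the radius contributes Γ_ℝ(z)/2. -/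
theorem integral_normSqVec_cpow_mul_gaussian {z : ℂ} (hz : 0 < z.re) :
    ∫ v : Fin 2 → ℝ, ((normSqVec v : ℝ) : ℂ) ^ ((z - 2) / 2) *
      (Real.exp (-Real.pi * normSqVec v) : ℂ) = Real.pi * Complex.Gammaℝ z := by
  rw [integral_vec_eq_prod, ← integral_comp_polarCoord_symm]
  have e : Set.EqOn (fun p : ℝ × ℝ => p.1 • (((normSqVec ![(polarCoord.symm p).1,
      (polarCoord.symm p).2] : ℝ) : ℂ) ^ ((z - 2) / 2) *
      (Real.exp (-Real.pi * normSqVec ![(polarCoord.symm p).1, (polarCoord.symm p).2]) : ℂ)))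
      (fun p : ℝ × ℝ => ((p.1 : ℂ) ^ (z - 1) * (Real.exp (-Real.pi * p.1 ^ 2) : ℂ)) *
        (fun _ : ℝ => (1 : ℂ)) p.2) polarCoord.target := by
    intro p hp
    have hp0 : (0 : ℝ) < p.1 := hp.1
    have hpc : (p.1 : ℂ) ≠ 0 := by exact_mod_cast hp0.ne'
    have e1 : normSqVec ![(polarCoord.symm p).1, (polarCoord.symm p).2] = p.1 ^ 2 := by
      simp only [normSqVec, polarCoord_symm_apply, Matrix.cons_val_zero, Matrix.cons_val_one]
      have := Real.cos_sq_add_sin_sq p.2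
      linear_combination p.1 ^ 2 * this
    have e2 : z - 1 = 1 + 2 * ((z - 2) / 2) := by ring
    simp only [e1]
    rw [ofReal_sq_cpow hp0, e2, Complex.cpow_add _ _ hpc, Complex.cpow_one, Complex.real_smul]
    ring
  rw [setIntegral_congr_fun polarCoord.open_target.measurableSet e, polarCoord_target,
    Measure.volume_eq_prod, setIntegral_prod_mul (fun x : ℝ => (x : ℂ) ^ (z - 1) *
      (Real.exp (-Real.pi * x ^ 2) : ℂ)) (fun _ : ℝ => (1 : ℂ)), integral_Ioi_cpow_mul_gaussian hz]
  have : ∫ _ in Set.Ioo (-Real.pi) Real.pi, (1 : ℂ) = 2 * Real.pi := by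
    rw [setIntegral_const, measureReal_def, Real.volume_Ioo,
      ENNReal.toReal_ofReal (by linarith [Real.pi_pos]), Complex.real_smul]
    push_cast
    ring
  rw [this]
  ring

theorem measurable_normSqVec : Measurable normSqVec := by
  unfold normSqVec; fun_prop

theorem integrable_normSqVec_cpow_mul_gaussian {z : ℂ} (hz : 0 < z.re) :
    Integrable fun v : Fin 2 → ℝ => ((normSqVec v : ℝ) : ℂ) ^ ((z - 2) / 2) *
      (Real.exp (-Real.pi * normSqVec v) : ℂ) := by
  have h : Integrable fun v : Fin 2 → ℝ => ((normSqVec v : ℝ) : ℂ) ^ (((z.re : ℂ) - 2) / 2) *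
      (Real.exp (-Real.pi * normSqVec v) : ℂ) := by
    apply Integrable.of_integral_ne_zero
    rw [integral_normSqVec_cpow_mul_gaussian (by simpa using hz)]
    exact mul_ne_zero (by exact_mod_cast Real.pi_ne_zero) (Gammaℝ_ofReal_ne_zero hz)
  refine h.mono ((((measurable_ofReal_cpow _).comp measurable_normSqVec).mul
    (Complex.measurable_ofReal.comp
      (Real.measurable_exp.comp (measurable_normSqVec.const_mul _)))).aestronglyMeasurable) ?_
  refine Filter.Eventually.of_forall fun v => ?_
  rw [norm_mul, norm_mul]
  gcongr
  have e : ((z.re : ℂ) - 2) / 2 = (((z - 2) / 2).re : ℂ) := by simp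
  rw [e]
  exact norm_ofReal_cpow_le (normSqVec_nonneg v) ((z - 2) / 2)

theorem measurable_crossVec : Measurable fun p : (Fin 2 → ℝ) × (Fin 2 → ℝ) =>
    crossVec p.1 p.2 := by
  unfold crossVec; fun_prop

/-! ### The local zeta integral in the two columns -/

/-- The integrand of the local zeta integral, as a function of the two columns. -/
def columnIntegrand (z₁ z₂ : ℂ) (u v : Fin 2 → ℝ) : ℂ :=
  ((normSqVec v : ℝ) : ℂ) ^ ((z₂ - z₁ - 1) / 2) * (Real.exp (-Real.pi * normSqVec v) : ℂ) *
    (((|crossVec u v| : ℝ) : ℂ) ^ (z₁ - 1) * (Real.exp (-Real.pi * normSqVec u) : ℂ))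

theorem measurable_columnIntegrand (z₁ z₂ : ℂ) :
    Measurable fun p : (Fin 2 → ℝ) × (Fin 2 → ℝ) => columnIntegrand z₁ z₂ p.1 p.2 := by
  have m1 : Measurable fun p : (Fin 2 → ℝ) × (Fin 2 → ℝ) => normSqVec p.1 :=
    measurable_normSqVec.comp measurable_fst
  have m2 : Measurable fun p : (Fin 2 → ℝ) × (Fin 2 → ℝ) => normSqVec p.2 :=
    measurable_normSqVec.comp measurable_snd
  exact (((measurable_ofReal_cpow _).comp m2).mul
    (Complex.measurable_ofReal.comp (Real.measurable_exp.comp (m2.const_mul _)))).mul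
    (((measurable_ofReal_cpow _).comp (measurable_norm.comp measurable_crossVec)).mul
    (Complex.measurable_ofReal.comp (Real.measurable_exp.comp (m1.const_mul _))))

theorem norm_columnIntegrand_le (z₁ z₂ : ℂ) (u v : Fin 2 → ℝ) :
    ‖columnIntegrand z₁ z₂ u v‖ ≤ ‖columnIntegrand z₁.re z₂.re u v‖ := by
  have e1 : ((z₂.re : ℂ) - z₁.re - 1) / 2 = (((z₂ - z₁ - 1) / 2).re : ℂ) := by simp
  have e2 : (z₁.re : ℂ) - 1 = ((z₁ - 1).re : ℂ) := by simp
  unfold columnIntegrand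
  rw [e1, e2]
  simp only [norm_mul]
  gcongr
  · exact norm_ofReal_cpow_le (normSqVec_nonneg v) _
  · exact norm_ofReal_cpow_le (abs_nonneg _) _

theorem norm_columnIntegrand_ofReal (r₁ r₂ : ℝ) (u v : Fin 2 → ℝ) :
    (‖columnIntegrand r₁ r₂ u v‖ : ℂ) = columnIntegrand r₁ r₂ u v := by
  have e1 : ((r₂ : ℂ) - r₁ - 1) / 2 = (((r₂ - r₁ - 1) / 2 : ℝ) : ℂ) := by push_cast; rfl
  have e2 : (r₁ : ℂ) - 1 = ((r₁ - 1 : ℝ) : ℂ) := by push_cast; rfl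
  have h1 := normSqVec_nonneg v
  unfold columnIntegrand
  rw [e1, e2, ← Complex.ofReal_cpow (normSqVec_nonneg v), ← Complex.ofReal_cpow (abs_nonneg _)]
  norm_cast
  rw [Real.norm_of_nonneg (by positivity)]

/-- Integration over u yields |v|^{z₁-1}, which turns the exponent z₂ - z₁ - 1 of |v| into z₂ - 2
and decouples the two Gamma factors. -/
theorem integrable_and_integral_columnIntegrand_fst {z₁ : ℂ} (h₁ : 0 < z₁.re) (z₂ : ℂ)
    {v : Fin 2 → ℝ} (hv : v ≠ 0) :
    Integrable (fun u => columnIntegrand z₁ z₂ u v) ∧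
    ∫ u, columnIntegrand z₁ z₂ u v = Complex.Gammaℝ z₁ *
      (((normSqVec v : ℝ) : ℂ) ^ ((z₂ - 2) / 2) * (Real.exp (-Real.pi * normSqVec v) : ℂ)) := by
  obtain ⟨i, e⟩ := integrable_and_integral_crossVec_cpow h₁ hv
  refine ⟨i.const_mul _, ?_⟩
  unfold columnIntegrand
  rw [integral_const_mul, e]
  have hc : ((normSqVec v : ℝ) : ℂ) ≠ 0 := by exact_mod_cast (normSqVec_pos hv).ne'
  have e2 : (z₂ - 2) / 2 = (z₂ - z₁ - 1) / 2 + (z₁ - 1) / 2 := by ring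
  rw [e2, Complex.cpow_add _ _ hc]
  ring

theorem ae_ne_zero_vec : ∀ᵐ v : Fin 2 → ℝ, v ≠ 0 := by
  rw [ae_iff]
  simp

/-- For real exponents the integrand equals its own norm, so the fibre formula computes the inner
integrals in Tonelli's criterion. The general case is dominated by this one. -/
theorem integrable_columnIntegrand {z₁ z₂ : ℂ} (h₁ : 0 < z₁.re) (h₂ : 0 < z₂.re) :
    Integrable fun p : (Fin 2 → ℝ) × (Fin 2 → ℝ) => columnIntegrand z₁ z₂ p.1 p.2 := by
  have h : Integrable fun p : (Fin 2 → ℝ) × (Fin 2 → ℝ) =>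
      columnIntegrand z₁.re z₂.re p.1 p.2 := by
    rw [Measure.volume_eq_prod, integrable_prod_iff'
      (measurable_columnIntegrand _ _).aestronglyMeasurable]
    refine ⟨?_, ?_⟩
    · filter_upwards [ae_ne_zero_vec] with v hv
      exact (integrable_and_integral_columnIntegrand_fst (by simpa using h₁) _ hv).1
    · have i := ((integrable_normSqVec_cpow_mul_gaussian (z := z₂.re) (by simpa using h₂)).const_mul
        (Complex.Gammaℝ z₁.re)).re
      refine i.congr ?_
      filter_upwards [ae_ne_zero_vec] with v hv
      rw [← (integrable_and_integral_columnIntegrand_fst (z₁ := z₁.re) (by simpa using h₁)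
        z₂.re hv).2]
      rw [← integral_congr_ae (Filter.Eventually.of_forall fun u =>
        norm_columnIntegrand_ofReal z₁.re z₂.re u v), integral_complex_ofReal]
      simp
  exact h.mono (measurable_columnIntegrand _ _).aestronglyMeasurable
    (Filter.Eventually.of_forall fun p => norm_columnIntegrand_le _ _ _ _)

theorem integral_columnIntegrand {z₁ z₂ : ℂ} (h₁ : 0 < z₁.re) (h₂ : 0 < z₂.re) :
    ∫ p : (Fin 2 → ℝ) × (Fin 2 → ℝ), columnIntegrand z₁ z₂ p.1 p.2 =
      Real.pi * (Complex.Gammaℝ z₁ * Complex.Gammaℝ z₂) := by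
  rw [Measure.volume_eq_prod, integral_prod_symm _ (integrable_columnIntegrand h₁ h₂)]
  have : ∀ᵐ v : Fin 2 → ℝ, ∫ u, columnIntegrand z₁ z₂ u v = Complex.Gammaℝ z₁ *
      (((normSqVec v : ℝ) : ℂ) ^ ((z₂ - 2) / 2) * (Real.exp (-Real.pi * normSqVec v) : ℂ)) := by
    filter_upwards [ae_ne_zero_vec] with v hv
    exact (integrable_and_integral_columnIntegrand_fst h₁ z₂ hv).2
  rw [integral_congr_ae this, integral_const_mul, integral_normSqVec_cpow_mul_gaussian h₂]
  ring

/-! ### From columns to matrices -/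

/-- The transposition of `2 × 2` arrays. -/
def transposeArray : (Fin 2 → Fin 2 → ℝ) ≃ᵐ (Fin 2 → Fin 2 → ℝ) where
  toFun A i j := A j i
  invFun A i j := A j i
  left_inv _ := rfl
  right_inv _ := rfl
  measurable_toFun := by
    change Measurable fun (A : Fin 2 → Fin 2 → ℝ) i j => A j i
    fun_prop
  measurable_invFun := by
    change Measurable fun (A : Fin 2 → Fin 2 → ℝ) i j => A j i
    fun_prop

/-- A linear involution has determinant ±1. -/
theorem measurePreserving_transposeArray :
    MeasurePreserving transposeArray volume volume := by
  refine ⟨transposeArray.measurable, ?_⟩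
  let T : (Fin 2 → Fin 2 → ℝ) →ₗ[ℝ] (Fin 2 → Fin 2 → ℝ) :=
    { toFun := fun A i j => A j i, map_add' := fun _ _ => rfl, map_smul' := fun _ _ => rfl }
  have hT : T ∘ₗ T = LinearMap.id := rfl
  have hd : LinearMap.det T * LinearMap.det T = 1 := by
    rw [← LinearMap.det_comp, hT, LinearMap.det_id]
  have h0 : LinearMap.det T ≠ 0 := left_ne_zero_of_mul_eq_one hd
  have habs : |(LinearMap.det T)⁻¹| = 1 := by
    rcases mul_self_eq_one_iff.1 hd with h | h <;> simp [h]
  have h := Measure.map_linearMap_addHaar_eq_smul_addHaar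
    (volume : Measure (Fin 2 → Fin 2 → ℝ)) h0
  rw [habs, ENNReal.ofReal_one, one_smul] at h
  exact h

/-- The integrand of the local zeta integral, as a function of the matrix. -/
def arrayIntegrand (z₁ z₂ : ℂ) (A : Fin 2 → Fin 2 → ℝ) : ℂ :=
  columnIntegrand z₁ z₂ (transposeArray A 0) (transposeArray A 1)

theorem integrable_arrayIntegrand {z₁ z₂ : ℂ} (h₁ : 0 < z₁.re) (h₂ : 0 < z₂.re) :
    Integrable (arrayIntegrand z₁ z₂) :=
  (measurePreserving_transposeArray.integrable_comp_emb
    (MeasurableEquiv.measurableEmbedding _)).2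
    (((volume_preserving_finTwoArrow (Fin 2 → ℝ)).integrable_comp_emb
    (MeasurableEquiv.measurableEmbedding _)).2 (integrable_columnIntegrand h₁ h₂))

theorem integral_arrayIntegrand {z₁ z₂ : ℂ} (h₁ : 0 < z₁.re) (h₂ : 0 < z₂.re) :
    ∫ A, arrayIntegrand z₁ z₂ A = Real.pi * (Complex.Gammaℝ z₁ * Complex.Gammaℝ z₂) := by
  rw [← integral_columnIntegrand h₁ h₂,
    ← (volume_preserving_finTwoArrow (Fin 2 → ℝ)).integral_comp',
    ← measurePreserving_transposeArray.integral_comp']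
  rfl

/-! ### Haar measure: density and right invariance -/

/-- The density of the Haar measure of `GL₂(ℝ)` with respect to Lebesgue measure. -/
def haarDensity (A : Fin 2 → Fin 2 → ℝ) : ℝ :=
  Real.pi⁻¹ * (|(Matrix.of A).det| ^ 2)⁻¹

theorem measurable_haarDensity : Measurable haarDensity := by
  have : Measurable fun A : Fin 2 → Fin 2 → ℝ => (Matrix.of A).det := by
    simp only [Matrix.det_fin_two, Matrix.of_apply]
    fun_prop
  unfold haarDensity
  fun_prop

theorem measurable_ofReal_haarDensity :
    Measurable fun A => ENNReal.ofReal (haarDensity A) :=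
  ENNReal.measurable_ofReal.comp measurable_haarDensity

theorem haarDensity_nonneg (A : Fin 2 → Fin 2 → ℝ) : 0 ≤ haarDensity A := by
  have := Real.pi_pos
  unfold haarDensity; positivity

/-- Relies on the convention 0⁻¹ = 0. It lets integrals over the group be written over all arrays,
with no restriction to the invertible ones. -/
theorem haarDensity_eq_zero {A : Fin 2 → Fin 2 → ℝ} (hA : A ∉ Set.range entries) :
    haarDensity A = 0 := by
  have : (Matrix.of A).det = 0 := by
    by_contra h
    exact hA ⟨Matrix.GeneralLinearGroup.mkOfDetNeZero (Matrix.of A) h, rfl⟩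
  simp [haarDensity, this]

theorem map_entries_haarGL :
    haarGL.map entries = volume.withDensity fun A => ENNReal.ofReal (haarDensity A) := by
  have hm := measurableEmbedding_entries
  ext S hS
  rw [hm.map_apply, haarGL, withDensity_apply _ (hm.measurable hS), withDensity_apply _ hS]
  have h1 : ∫⁻ h in entries ⁻¹' S, ENNReal.ofReal (Real.pi⁻¹ * (|h.val.det| ^ 2)⁻¹)
      ∂(Measure.comap entries volume) =
      ∫⁻ h in entries ⁻¹' S, ENNReal.ofReal (haarDensity (entries h))
      ∂(Measure.comap entries volume) := rfl
  rw [h1, ← hm.lintegral_map (μ := (Measure.comap entries volume).restrict (entries ⁻¹' S))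
    (f := fun A => ENNReal.ofReal (haarDensity A)), ← hm.restrict_map, hm.map_comap,
    Measure.restrict_restrict hS, ← lintegral_indicator (hS.inter hm.measurableSet_range),
    ← lintegral_indicator hS]
  congr 1
  funext A
  by_cases hA : A ∈ Set.range entries
  · by_cases hAS : A ∈ S <;> simp [Set.indicator, hA, hAS]
  · simp [Set.indicator, hA, haarDensity_eq_zero hA]

/-- Right multiplication of arrays by a matrix. -/
def arrayMul (y : Matrix (Fin 2) (Fin 2) ℝ) (A : Fin 2 → Fin 2 → ℝ) : Fin 2 → Fin 2 → ℝ :=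
  fun i => y.transpose.mulVec (A i)

theorem entries_mul (h y : GL (Fin 2) ℝ) : entries (h * y) = arrayMul y.val (entries h) := by
  ext i j
  change (h.val * y.val) i j = _
  simp [arrayMul, Matrix.mulVec_transpose, Matrix.mul_apply, Matrix.vecMul, dotProduct, entries]

theorem measurable_arrayMul (y : Matrix (Fin 2) (Fin 2) ℝ) : Measurable (arrayMul y) := by
  refine measurable_pi_lambda _ fun i => ?_
  exact ((Matrix.mulVecLin y.transpose).continuous_of_finiteDimensional.measurable).comp
    (measurable_pi_apply i)

/-- Right multiplication acts on each row separately by yᵀ, so the Jacobian occurs once for each of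
the two rows. -/
theorem map_arrayMul_volume {y : Matrix (Fin 2) (Fin 2) ℝ} (hy : y.det ≠ 0) :
    (volume : Measure (Fin 2 → Fin 2 → ℝ)).map (arrayMul y) =
      (ENNReal.ofReal |y.det|⁻¹) ^ 2 • volume := by
  have hy' : y.transpose.det ≠ 0 := by rwa [Matrix.det_transpose]
  have hrow : (volume : Measure (Fin 2 → ℝ)).map y.transpose.mulVec =
      ENNReal.ofReal |y.det|⁻¹ • volume := by
    have h := Real.map_matrix_volume_pi_eq_smul_volume_pi hy'
    rw [Matrix.det_transpose, abs_inv] at h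
    exact h
  have hm : Measurable y.transpose.mulVec :=
    (Matrix.mulVecLin y.transpose).continuous_of_finiteDimensional.measurable
  set c : NNReal := Real.toNNReal |y.det|⁻¹ with hc
  have hrow' : (volume : Measure (Fin 2 → ℝ)).map y.transpose.mulVec = c • volume := hrow
  have : SigmaFinite ((volume : Measure (Fin 2 → ℝ)).map y.transpose.mulVec) := by
    rw [hrow']; infer_instance
  have h := Measure.pi_map_pi (μ := fun _ : Fin 2 => (volume : Measure (Fin 2 → ℝ)))
    (f := fun _ : Fin 2 => y.transpose.mulVec) (fun _ => hm.aemeasurable)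
  refine h.trans (Measure.pi_eq fun s hs => ?_)
  simp only [hrow, Measure.smul_apply, smul_eq_mul, Fin.prod_univ_two]
  rw [volume_pi, Measure.pi_pi, Fin.prod_univ_two]
  ring

theorem haarDensity_arrayMul (y : Matrix (Fin 2) (Fin 2) ℝ) (A : Fin 2 → Fin 2 → ℝ) :
    haarDensity (arrayMul y A) = (|y.det|⁻¹) ^ 2 * haarDensity A := by
  have : Matrix.of (arrayMul y A) = Matrix.of A * y := by
    ext i j
    simp [arrayMul, Matrix.mulVec_transpose, Matrix.mul_apply, Matrix.vecMul, dotProduct]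
  rw [haarDensity, haarDensity, this, Matrix.det_mul, abs_mul, mul_pow, mul_inv, inv_pow]
  ring

/-- The density and Lebesgue measure scale by the same factor |det y|⁻²; it is finite and nonzero,
hence cancels. -/
theorem map_arrayMul_withDensity {y : Matrix (Fin 2) (Fin 2) ℝ} (hy : y.det ≠ 0) :
    ((volume : Measure (Fin 2 → Fin 2 → ℝ)).withDensity
      fun A => ENNReal.ofReal (haarDensity A)).map (arrayMul y) =
    volume.withDensity fun A => ENNReal.ofReal (haarDensity A) := by
  have hm := measurable_arrayMul y
  have hpos : 0 < |y.det|⁻¹ := inv_pos.2 (abs_pos.2 hy)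
  set c := ENNReal.ofReal |y.det|⁻¹ with hc
  have hc0 : c ^ 2 ≠ 0 := pow_ne_zero _ (by simpa [hc] using hy)
  have hct : c ^ 2 ≠ ⊤ := ENNReal.pow_ne_top ENNReal.ofReal_ne_top
  ext S hS
  rw [Measure.map_apply hm hS, withDensity_apply _ (hm hS), withDensity_apply _ hS,
    ← ENNReal.mul_right_inj hc0 hct, ← lintegral_const_mul _ measurable_ofReal_haarDensity]
  have e : ∀ A, c ^ 2 * ENNReal.ofReal (haarDensity A) =
      ENNReal.ofReal (haarDensity (arrayMul y A)) := by
    intro A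
    rw [haarDensity_arrayMul, ENNReal.ofReal_mul (by positivity), ENNReal.ofReal_pow hpos.le]
  simp_rw [e]
  rw [← setLIntegral_map hS measurable_ofReal_haarDensity hm, map_arrayMul_volume hy,
    Measure.restrict_smul,
    lintegral_smul_measure, smul_eq_mul]

theorem det_ne_zero (g : GL (Fin 2) ℝ) : g.val.det ≠ 0 :=
  ((Matrix.isUnit_iff_isUnit_det _).1 g.isUnit).ne_zero

theorem measurable_entries : Measurable entries := measurableEmbedding_entries.measurable

theorem measurable_mul_right (y : GL (Fin 2) ℝ) :
    Measurable fun h : GL (Fin 2) ℝ => h * y := by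
  rw [← measurableEmbedding_entries.measurable_comp_iff]
  have : entries ∘ (fun h : GL (Fin 2) ℝ => h * y) = arrayMul y.val ∘ entries := by
    funext h
    exact entries_mul h y
  rw [this]
  exact (measurable_arrayMul _).comp measurable_entries

theorem measurePreserving_mul_right (y : GL (Fin 2) ℝ) :
    MeasurePreserving (fun h : GL (Fin 2) ℝ => h * y) haarGL haarGL := by
  refine ⟨measurable_mul_right y, ?_⟩
  have e : (haarGL.map fun h => h * y).map entries = haarGL.map entries := by
    rw [Measure.map_map measurable_entries (measurable_mul_right y)]
    have : entries ∘ (fun h : GL (Fin 2) ℝ => h * y) = arrayMul y.val ∘ entries := by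
      funext h
      exact entries_mul h y
    rw [this, ← Measure.map_map (measurable_arrayMul _) measurable_entries, map_entries_haarGL,
      map_arrayMul_withDensity (det_ne_zero y)]
  rw [← measurableEmbedding_entries.comap_map (haarGL.map fun h => h * y), e,
    measurableEmbedding_entries.comap_map]

theorem measurableEmbedding_mul_right (y : GL (Fin 2) ℝ) :
    MeasurableEmbedding fun h : GL (Fin 2) ℝ => h * y :=
  MeasurableEquiv.measurableEmbedding
    { toFun := fun h => h * y
      invFun := fun h => h * y⁻¹
      left_inv := fun h => mul_inv_cancel_right h y
      right_inv := fun h => inv_mul_cancel_right h y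
      measurable_toFun := measurable_mul_right y
      measurable_invFun := measurable_mul_right y⁻¹ }

theorem integral_mul_right (f : GL (Fin 2) ℝ → ℂ) (y : GL (Fin 2) ℝ) :
    ∫ h, f (h * y) ∂haarGL = ∫ h, f h ∂haarGL :=
  (measurePreserving_mul_right y).integral_comp (measurableEmbedding_mul_right y) f

theorem integrable_mul_right_iff (f : GL (Fin 2) ℝ → ℂ) (y : GL (Fin 2) ℝ) :
    Integrable (fun h => f (h * y)) haarGL ↔ Integrable f haarGL :=
  (measurePreserving_mul_right y).integrable_comp_emb (measurableEmbedding_mul_right y)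

theorem integral_comp_entries (f : (Fin 2 → Fin 2 → ℝ) → ℂ) :
    ∫ h, f (entries h) ∂haarGL = ∫ A, (haarDensity A : ℂ) * f A := by
  rw [← measurableEmbedding_entries.integral_map, map_entries_haarGL,
    integral_withDensity_eq_integral_toReal_smul
    measurable_ofReal_haarDensity
    (Filter.Eventually.of_forall fun _ => ENNReal.ofReal_lt_top)]
  refine integral_congr_ae (Filter.Eventually.of_forall fun A => ?_)
  simp [ENNReal.toReal_ofReal (haarDensity_nonneg A)]

theorem integrable_comp_entries_iff (f : (Fin 2 → Fin 2 → ℝ) → ℂ) :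
    Integrable (fun h => f (entries h)) haarGL ↔
      Integrable fun A => (haarDensity A : ℂ) * f A := by
  have h := measurableEmbedding_entries.integrable_map_iff (g := f) (μ := haarGL)
  rw [map_entries_haarGL] at h
  refine h.symm.trans ?_
  rw [integrable_withDensity_iff_integrable_smul'
    measurable_ofReal_haarDensity
    (Filter.Eventually.of_forall fun _ => ENNReal.ofReal_lt_top)]
  refine integrable_congr (Filter.Eventually.of_forall fun A => ?_)
  simp [ENNReal.toReal_ofReal (haarDensity_nonneg A)]

/-! ### The local eigenvalue -/

/-- The Gaussian `exp(-π Tr(hᵀ h))`. -/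
def gaussian (A : Fin 2 → Fin 2 → ℝ) : ℝ :=
  Real.exp (-Real.pi * (A 0 0 ^ 2 + A 0 1 ^ 2 + A 1 0 ^ 2 + A 1 1 ^ 2))

/-- The local Hecke-Baxter kernel `|det h|^{s + 1/2} exp(-π Tr(hᵀ h))`. -/
def localKernel (s : ℂ) (h : GL (Fin 2) ℝ) : ℂ :=
  ((|h.val.det| : ℝ) : ℂ) ^ (s + 1 / 2) * (gaussian (entries h) : ℂ)

theorem inv_row (h : GL (Fin 2) ℝ) :
    h⁻¹ 0 0 = h 1 1 / h.val.det ∧ h⁻¹ 0 1 = -h 0 1 / h.val.det := by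
  rw [Matrix.GeneralLinearGroup.coe_inv, Matrix.inv_def, Matrix.adjugate_fin_two]
  constructor <;> simp [div_eq_inv_mul]

theorem abs_det_inv (h : GL (Fin 2) ℝ) : |(h⁻¹).val.det| = |h.val.det|⁻¹ := by
  rw [Matrix.GeneralLinearGroup.coe_inv, Matrix.det_nonsing_inv, Ring.inverse_eq_inv', abs_inv]

/-- The function `h ↦ |det h|^{s + 1/2} exp(-π Tr(hᵀ h)) φ_{O₂}(h⁻¹)` of the entries of `h`. -/
def localIntegrand (γ : Fin 2 → ℂ) (s : ℂ) (A : Fin 2 → Fin 2 → ℝ) : ℂ :=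
  ((|(Matrix.of A).det| : ℝ) : ℂ) ^ (s + 1 / 2) * (gaussian A : ℂ) *
      (((|(Matrix.of A).det|⁻¹ : ℝ) : ℂ) ^ (Complex.I * γ 1 + 1 / 2) *
      (((A 1 1 / (Matrix.of A).det) ^ 2 + (-A 0 1 / (Matrix.of A).det) ^ 2 : ℝ) : ℂ) ^
        ((Complex.I * (γ 0 - γ 1) - 1) / 2))

/-- Collecting the powers of |det|: the density gives -2, the kernel s + 1/2, and φ(h⁻¹) the rest,
for a total of z₁ - 1. The squared first row of h⁻¹ is |v|²/det², which leaves the power of |v|. -/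
theorem haarDensity_mul_integrand {γ : Fin 2 → ℂ} {s : ℂ}
    (hs : 1 < (s - Complex.I * γ 0).re) (A : Fin 2 → Fin 2 → ℝ) :
    (haarDensity A : ℂ) * localIntegrand γ s A =
      (Real.pi : ℂ)⁻¹ * arrayIntegrand (s - Complex.I * γ 0) (s - Complex.I * γ 1) A := by
  set u := transposeArray A 0 with hu
  set v := transposeArray A 1 with hv
  have hc : crossVec u v = (Matrix.of A).det := by
    rw [Matrix.det_fin_two]
    simp only [crossVec, hu, hv, transposeArray, MeasurableEquiv.coe_mk, Equiv.coe_fn_mk,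
      Matrix.of_apply]
    ring
  rw [arrayIntegrand, ← hu, ← hv, columnIntegrand, hc, localIntegrand]
  set D := (Matrix.of A).det with hD
  by_cases h0 : D = 0
  -- On singular arrays the left side vanishes through the density and the right side through
  -- 0^{z₁-1}, which is 0 because z₁ ≠ 1.
  · have hne : s - Complex.I * γ 0 - 1 ≠ 0 := by
      intro h
      have h' := congrArg Complex.re h
      rw [Complex.sub_re, Complex.one_re, Complex.zero_re] at h'
      linarith
    have : haarDensity A = 0 := by
      simp [haarDensity, ← hD, h0]
    rw [this, h0, abs_zero, Complex.ofReal_zero, Complex.zero_cpow hne]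
    ring
  have hp : 0 < |D| := abs_pos.2 h0
  have hpc : ((|D| : ℝ) : ℂ) ≠ 0 := by exact_mod_cast hp.ne'
  have hq : (A 1 1 / D) ^ 2 + (-A 0 1 / D) ^ 2 = normSqVec v * |D|⁻¹ ^ 2 := by
    have : normSqVec v = A 0 1 ^ 2 + A 1 1 ^ 2 := rfl
    rw [this, inv_pow, sq_abs]
    field_simp
    ring
  have hg : (gaussian A : ℂ) = (Real.exp (-Real.pi * normSqVec v) : ℂ) *
      (Real.exp (-Real.pi * normSqVec u) : ℂ) := by
    rw [← ofReal_exp_add]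
    have : normSqVec v + normSqVec u = A 0 0 ^ 2 + A 0 1 ^ 2 + A 1 0 ^ 2 + A 1 1 ^ 2 := by
      change (A 0 1 ^ 2 + A 1 1 ^ 2) + (A 0 0 ^ 2 + A 1 0 ^ 2) = _
      ring
    rw [this, gaussian]
  have hinv : ∀ b : ℂ, ((|D|⁻¹ : ℝ) : ℂ) ^ b = ((|D| : ℝ) : ℂ) ^ (-b) := by
    intro b
    rw [← Real.rpow_neg_one, ofReal_rpow_cpow hp]
    congr 1
    push_cast
    ring
  have hden : (haarDensity A : ℂ) = (Real.pi : ℂ)⁻¹ * ((|D| : ℝ) : ℂ) ^ (-2 : ℂ) := by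
    rw [haarDensity, ← hD, Complex.cpow_neg, Complex.cpow_ofNat]
    push_cast
    rfl
  have hexp : s - Complex.I * γ 0 - 1 = (-2) + (s + 1 / 2) + -(Complex.I * γ 1 + 1 / 2) +
      -(2 * ((Complex.I * (γ 0 - γ 1) - 1) / 2)) := by ring
  have hpow : ((|D| : ℝ) : ℂ) ^ (s - Complex.I * γ 0 - 1) =
      ((|D| : ℝ) : ℂ) ^ (-2 : ℂ) * ((|D| : ℝ) : ℂ) ^ (s + 1 / 2) *
      ((|D| : ℝ) : ℂ) ^ (-(Complex.I * γ 1 + 1 / 2)) *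
      ((|D| : ℝ) : ℂ) ^ (-(2 * ((Complex.I * (γ 0 - γ 1) - 1) / 2))) := by
    rw [hexp, Complex.cpow_add _ _ hpc, Complex.cpow_add _ _ hpc, Complex.cpow_add _ _ hpc]
  have hexp2 : (s - Complex.I * γ 1 - (s - Complex.I * γ 0) - 1) / 2 =
      (Complex.I * (γ 0 - γ 1) - 1) / 2 := by ring
  rw [hq, hg, hden, Complex.ofReal_mul (normSqVec v), Complex.mul_cpow_ofReal_nonneg
    (normSqVec_nonneg v) (by positivity), ofReal_sq_cpow (inv_pos.2 hp), hinv, hinv, hpow, hexp2]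
  ring

theorem localKernel_mul_sphericalFun_inv (γ : Fin 2 → ℂ) (s : ℂ) (h : GL (Fin 2) ℝ) :
    localKernel s h * sphericalFun γ h⁻¹ =
    localIntegrand γ s (entries h) := by
  rw [sphericalFun, abs_det_inv, (inv_row h).1, (inv_row h).2]
  rfl

theorem integrable_and_integral_localKernel_one {γ : Fin 2 → ℂ} {s : ℂ}
    (hs : ∀ j, 1 < (s - Complex.I * γ j).re) :
    Integrable (fun h => localKernel s h * sphericalFun γ h⁻¹) haarGL ∧
    ∫ h, localKernel s h * sphericalFun γ h⁻¹ ∂haarGL =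
      Complex.Gammaℝ (s - Complex.I * γ 0) * Complex.Gammaℝ (s - Complex.I * γ 1) := by
  have h₁ : 0 < (s - Complex.I * γ 0).re := one_pos.trans (hs 0)
  have h₂ : 0 < (s - Complex.I * γ 1).re := one_pos.trans (hs 1)
  simp_rw [localKernel_mul_sphericalFun_inv]
  rw [integrable_comp_entries_iff, integral_comp_entries]
  simp_rw [haarDensity_mul_integrand (hs 0)]
  refine ⟨(integrable_arrayIntegrand h₁ h₂).const_mul _, ?_⟩
  rw [integral_const_mul, integral_arrayIntegrand h₁ h₂, ← mul_assoc, inv_mul_cancel₀, one_mul]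
  exact_mod_cast Real.pi_ne_zero

/-- Every invertible matrix is the product of a lower triangular matrix and a rotation. -/
theorem exists_rotation (x : GL (Fin 2) ℝ) :
    ∃ k : GL (Fin 2) ℝ, k.val.det = 1 ∧ k.val * k.val.transpose = 1 ∧
      k 0 0 ^ 2 + k 0 1 ^ 2 = 1 ∧ (x * k⁻¹) 0 1 = 0 := by
  have hq := row_sq_pos x
  set r := Real.sqrt (x 0 0 ^ 2 + x 0 1 ^ 2) with hr
  have hr0 : 0 < r := Real.sqrt_pos.2 hq
  have hrq : r ^ 2 = x 0 0 ^ 2 + x 0 1 ^ 2 := Real.sq_sqrt hq.le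
  have hd : (!![x 0 0 / r, x 0 1 / r; -x 0 1 / r, x 0 0 / r] : Matrix (Fin 2) (Fin 2) ℝ).det
      = 1 := by
    rw [Matrix.det_fin_two_of]
    field_simp
    linarith
  let k : GL (Fin 2) ℝ := Matrix.GeneralLinearGroup.mkOfDetNeZero
    !![x 0 0 / r, x 0 1 / r; -x 0 1 / r, x 0 0 / r] (by rw [hd]; exact one_ne_zero)
  have hk : k.val = !![x 0 0 / r, x 0 1 / r; -x 0 1 / r, x 0 0 / r] := rfl
  refine ⟨k, hd, ?_, ?_, ?_⟩
  · rw [hk]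
    ext i j
    fin_cases i <;> fin_cases j <;> simp [Matrix.mul_apply, Fin.sum_univ_two] <;> field_simp <;>
      linarith
  · rw [hk]
    simp only [Matrix.of_apply, Matrix.cons_val', Matrix.cons_val_zero, Matrix.cons_val_one,
      Matrix.cons_val_fin_one]
    field_simp
    linarith
  · have h01 : k⁻¹ 0 1 = -(x 0 1 / r) := by
      rw [Matrix.GeneralLinearGroup.coe_inv, Matrix.inv_def, hk, hd, Matrix.adjugate_fin_two_of]
      simp
    have h11 : k⁻¹ 1 1 = x 0 0 / r := by
      rw [Matrix.GeneralLinearGroup.coe_inv, Matrix.inv_def, hk, hd, Matrix.adjugate_fin_two_of]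
      simp
    rw [Matrix.GeneralLinearGroup.coe_mul, Matrix.mul_apply, Fin.sum_univ_two, h01, h11]
    ring

theorem localKernel_mul_rotation (s : ℂ) (h k : GL (Fin 2) ℝ) (hd : k.val.det = 1)
    (hk : k.val * k.val.transpose = 1) : localKernel s (h * k) = localKernel s h := by
  have h00 := congrFun (congrFun hk 0) 0
  have h01 := congrFun (congrFun hk 0) 1
  have h11 := congrFun (congrFun hk 1) 1
  simp only [Matrix.mul_apply, Fin.sum_univ_two, Matrix.transpose_apply, Matrix.one_apply_eq,
    ne_eq, zero_ne_one, not_false_eq_true, Matrix.one_apply_ne] at h00 h01 h11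
  have e : ∀ i, (h * k) i 0 ^ 2 + (h * k) i 1 ^ 2 = h i 0 ^ 2 + h i 1 ^ 2 := by
    intro i
    rw [Matrix.GeneralLinearGroup.coe_mul, Matrix.mul_apply, Matrix.mul_apply, Fin.sum_univ_two,
      Fin.sum_univ_two]
    linear_combination (h i 0) ^ 2 * h00 + 2 * h i 0 * h i 1 * h01 + (h i 1) ^ 2 * h11
  have e2 : gaussian (entries (h * k)) = gaussian (entries h) := by
    unfold gaussian entries
    have e0 := e 0
    have e1 := e 1
    congr 2
    linarith
  rw [localKernel, localKernel, e2, Matrix.GeneralLinearGroup.coe_mul, Matrix.det_mul, hd, mul_one]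

/-- Write x = bk with b lower triangular and k a rotation, and replace h by hk. The kernel does not
change, and φ(bh⁻¹) is the character of b times φ(h⁻¹). This reduces to x = 1, and φ(x) is that same
character value. -/
theorem integrable_and_integral_localKernel {γ : Fin 2 → ℂ} {s : ℂ}
    (hs : ∀ j, 1 < (s - Complex.I * γ j).re) (x : GL (Fin 2) ℝ) :
    Integrable (fun h => localKernel s h * sphericalFun γ (x * h⁻¹)) haarGL ∧
    ∫ h, localKernel s h * sphericalFun γ (x * h⁻¹) ∂haarGL =
      Complex.Gammaℝ (s - Complex.I * γ 0) * Complex.Gammaℝ (s - Complex.I * γ 1) *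
        sphericalFun γ x := by
  obtain ⟨k, hd, hk, hrow, hb⟩ := exists_rotation x
  obtain ⟨i1, e1⟩ := integrable_and_integral_localKernel_one hs
  have hx : sphericalFun γ x = borelCharacter γ (x * k⁻¹) := by
    have h := sphericalFun_mem γ (x * k⁻¹) k hb
    rw [inv_mul_cancel_right] at h
    rw [h, sphericalFun, hd, hrow]
    simp
  have e : ∀ h : GL (Fin 2) ℝ, localKernel s (h * k) * sphericalFun γ (x * (h * k)⁻¹) =
      borelCharacter γ (x * k⁻¹) * (localKernel s h * sphericalFun γ h⁻¹) := by
    intro h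
    rw [localKernel_mul_rotation s h k hd hk, mul_inv_rev, ← mul_assoc,
      sphericalFun_mem γ (x * k⁻¹) h⁻¹ hb]
    ring
  rw [← integrable_mul_right_iff _ k, ← integral_mul_right _ k]
  simp_rw [e]
  refine ⟨i1.const_mul _, ?_⟩
  rw [integral_const_mul, e1, hx]
  ring

/-! ### Lower triangular representatives of cosets -/

/-- The representatives `(k 0; c l)`, `k, l > 0`, `0 ≤ c < k`, given by `k`, `c` and `l`. -/
abbrev LowerRep : Type := (k : ℕ+) × (Fin k × ℕ+)

/-- The matrix `(k 0; c l)`. -/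
def LowerRep.toMatrix (β : LowerRep) : Matrix (Fin 2) (Fin 2) ℤ :=
  !![((β.1 : ℕ) : ℤ), 0; ((β.2.1 : ℕ) : ℤ), ((β.2.2 : ℕ) : ℤ)]

/-- Bézout relations for p and q make k and l divide each other; the lexicographic positivity of
both representatives excludes the sign -1. -/
theorem PrimitivePair.eq_of_mul_eq {p q : PrimitivePair} {e e' k l : ℤ} (he : e * e' = 1)
    (hk : 0 < k) (hl : 0 < l) (h1 : e * (k * p.val.1) = l * q.val.1)
    (h2 : e * (k * p.val.2) = l * q.val.2) : e = 1 ∧ k = l ∧ p = q := by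
  obtain ⟨⟨p1, p2⟩, ⟨u, v, huv⟩, hp⟩ := p
  obtain ⟨⟨q1, q2⟩, ⟨u', v', huv'⟩, hq⟩ := q
  simp only at *
  have he1 : e = 1 := by
    rcases Int.isUnit_iff.1 (IsUnit.of_mul_eq_one e' he) with h | h
    · exact h
    · exfalso
      subst h
      rcases hp with hp | ⟨hp, hp'⟩ <;> rcases hq with hq | ⟨hq, hq'⟩
      · nlinarith [mul_pos hk hp, mul_pos hl hq]
      · subst hq
        nlinarith [mul_pos hk hp]
      · subst hp
        nlinarith [mul_pos hl hq]
      · nlinarith [mul_pos hk hp', mul_pos hl hq']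
  subst he1
  rw [one_mul] at h1 h2
  have d1 : l ∣ k := ⟨u * q1 + v * q2, by linear_combination (-k) * huv + u * h1 + v * h2⟩
  have d2 : k ∣ l := ⟨u' * p1 + v' * p2, by
    linear_combination (-l) * huv' - u' * h1 - v' * h2⟩
  have hkl : k = l := Int.dvd_antisymm hk.le hl.le d2 d1
  subst hkl
  refine ⟨rfl, rfl, ?_⟩
  simp only [mul_right_inj' hk.ne'] at h1 h2
  subst h1 h2
  rfl

theorem exists_primitivePair (a b : ℤ) (h : a ≠ 0 ∨ b ≠ 0) :
    ∃ (p : PrimitivePair) (e : ℤ) (k : ℕ+), e * e = 1 ∧ a = e * (((k : ℕ) : ℤ) * p.val.1) ∧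
      b = e * (((k : ℕ) : ℤ) * p.val.2) := by
  have hg : 0 < Int.gcd a b := Int.gcd_pos_iff.2 h
  obtain ⟨a', b', hab, ha, hb⟩ := Int.exists_gcd_one hg
  have hc : IsCoprime a' b' := Int.isCoprime_iff_gcd_eq_one.2 hab
  by_cases hs : 0 < a' ∨ a' = 0 ∧ 0 < b'
  · refine ⟨⟨(a', b'), hc, hs⟩, 1, ⟨Int.gcd a b, hg⟩, by norm_num, ?_, ?_⟩
    · simp only [PNat.mk_coe]; linarith
    · simp only [PNat.mk_coe]; linarith
  · refine ⟨⟨(-a', -b'), hc.neg_neg, ?_⟩, -1, ⟨Int.gcd a b, hg⟩, by norm_num, ?_, ?_⟩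
    · rcases lt_trichotomy a' 0 with h0 | h0 | h0
      · left; simpa using h0
      · right
        refine ⟨by simpa using h0, ?_⟩
        have : b' ≠ 0 := by
          rintro rfl
          subst h0
          simp at hab
        simp only [not_or, not_and, not_lt] at hs
        have := hs.2 h0
        simp only; omega
      · exact absurd (Or.inl h0) hs
    · simp only [PNat.mk_coe]; linarith
    · simp only [PNat.mk_coe]; linarith

/-- Cosets of the lower triangular subgroup: `N M = β δ_q`. -/
theorem exists_lowerRep {M : Matrix (Fin 2) (Fin 2) ℤ} (hM : 0 < M.det) :
    ∃ (N : Matrix.SpecialLinearGroup (Fin 2) ℤ) (q : PrimitivePair) (β : LowerRep),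
      N 0 1 = 0 ∧ N.val * M = β.toMatrix * (primitiveMatrix q).val := by
  rw [Matrix.det_fin_two] at hM
  have h0 : M 0 0 ≠ 0 ∨ M 0 1 ≠ 0 := by
    by_contra h
    simp only [not_or, not_not] at h
    simp [h.1, h.2] at hM
  obtain ⟨q, e, k, he, ha, hb⟩ := exists_primitivePair _ _ h0
  obtain ⟨q10, hq10⟩ : ∃ x, (primitiveMatrix q) 1 0 = x := ⟨_, rfl⟩
  obtain ⟨q11, hq11⟩ : ∃ x, (primitiveMatrix q) 1 1 = x := ⟨_, rfl⟩
  obtain ⟨q1, hq1⟩ : ∃ x, q.val.1 = x := ⟨_, rfl⟩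
  obtain ⟨q2, hq2⟩ : ∃ x, q.val.2 = x := ⟨_, rfl⟩
  have hq00 : (primitiveMatrix q) 0 0 = q1 := hq1
  have hq01 : (primitiveMatrix q) 0 1 = q2 := hq2
  have hdet : q1 * q11 - q2 * q10 = 1 := by
    have := (primitiveMatrix q).det_coe
    rw [Matrix.det_fin_two] at this
    rw [← hq00, ← hq01, ← hq10, ← hq11]
    exact this
  rw [hq1] at ha
  rw [hq2] at hb
  set K : ℤ := ((k : ℕ) : ℤ) with hK
  have hK0 : 0 < K := by simp [hK]
  -- Coordinates of the second row of M in the ℤ-basis given by the rows of δ_q.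
  set c' := M 1 0 * q11 - M 1 1 * q10 with hc'
  set l' := M 1 1 * q1 - M 1 0 * q2 with hl'
  have hl : 0 < e * l' := by
    rw [ha, hb] at hM
    have : 0 < K * (e * l') := by
      rw [hl']
      linarith
    exact (mul_pos_iff_of_pos_left hK0).1 this
  have hcm := Int.emod_nonneg (e * c') hK0.ne'
  have hcl := Int.emod_lt_of_pos (e * c') hK0
  have hce := Int.emod_add_mul_ediv (e * c') K
  set c := e * c' % K with hc
  set x := e * c' / K with hx
  -- The sign e normalizes the first row; subtracting x times that row from the second reduces c to
  -- its residue modulo k.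
  refine ⟨⟨!![e, 0; -x * e, e], by rw [Matrix.det_fin_two_of]; linarith⟩, q,
    ⟨k, ⟨c.toNat, by omega⟩, ⟨(e * l').toNat, by omega⟩⟩, rfl, ?_⟩
  have hcn : ((c.toNat : ℕ) : ℤ) = c := Int.toNat_of_nonneg hcm
  have hln : (((e * l').toNat : ℕ) : ℤ) = e * l' := Int.toNat_of_nonneg hl.le
  have m10 : M 1 0 = c' * q1 + l' * q10 := by
    rw [hc', hl']; linear_combination (-M 1 0) * hdet
  have m11 : M 1 1 = c' * q2 + l' * q11 := by
    rw [hc', hl']; linear_combination (-M 1 1) * hdet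
  ext i j
  fin_cases i <;> fin_cases j <;>
    simp [LowerRep.toMatrix, Matrix.mul_apply, Fin.sum_univ_two, hcn, hln]
  · erw [hq00]
    rw [ha]
    linear_combination (K * q1) * he
  · erw [hq01]
    rw [hb]
    linear_combination (K * q2) * he
  · erw [hq00, hq10]
    rw [ha, m10]
    linear_combination (-x * K * q1) * he - q1 * hce
  · erw [hq01, hq11]
    rw [hb, m11]
    linear_combination (-x * K * q2) * he - q2 * hce

theorem SpecialLinearGroup.mul_eq_one_of_lower (N : Matrix.SpecialLinearGroup (Fin 2) ℤ)
    (hN : N 0 1 = 0) : N 0 0 * N 1 1 = 1 := by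
  have h := N.det_coe
  rw [Matrix.det_fin_two] at h
  have h0 : N.val 0 1 = 0 := hN
  rw [h0, zero_mul, sub_zero] at h
  exact h

/-- The first rows determine q, k and the sign of N. After cancelling δ_q, the second rows give l =
l' and c ≡ c' modulo k, with both residues in [0, k). -/
theorem lowerRep_unique {N : Matrix.SpecialLinearGroup (Fin 2) ℤ} (hN : N 0 1 = 0)
    {q q' : PrimitivePair} {β β' : LowerRep}
    (h : N.val * (β.toMatrix * (primitiveMatrix q).val) =
      β'.toMatrix * (primitiveMatrix q').val) : q = q' ∧ β = β' := by
  have hN1 := SpecialLinearGroup.mul_eq_one_of_lower N hN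
  have hN' : N.val 0 1 = 0 := hN
  obtain ⟨k, c, l⟩ := β
  obtain ⟨k', c', l'⟩ := β'
  have r0 := congrFun (congrFun h 0) 0
  have r1 := congrFun (congrFun h 0) 1
  simp only [LowerRep.toMatrix, Matrix.mul_apply, Fin.sum_univ_two, Matrix.of_apply,
    Matrix.cons_val', Matrix.cons_val_zero, Matrix.cons_val_one, Matrix.cons_val_fin_one, hN',
    zero_mul, add_zero] at r0 r1
  obtain ⟨e1, e2, rfl⟩ := PrimitivePair.eq_of_mul_eq (p := q) (q := q') hN1
    (k := ((k : ℕ) : ℤ)) (l := ((k' : ℕ) : ℤ)) (by simp) (by simp) r0 r1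
  have hk : k = k' := by exact_mod_cast e2
  subst hk
  have hinj : N.val * (LowerRep.toMatrix ⟨k, c, l⟩) = LowerRep.toMatrix ⟨k, c', l'⟩ := by
    have hd : IsUnit (primitiveMatrix q).val.det := by
      rw [(primitiveMatrix q).det_coe]; exact isUnit_one
    rw [← mul_assoc] at h
    have := congrArg (· * (primitiveMatrix q).val⁻¹) h
    simpa [Matrix.mul_nonsing_inv_cancel_right _ _ hd] using this
  have e11 : N.val 1 1 = 1 := by
    have : N.val 0 0 = 1 := e1
    have h1 : N.val 0 0 * N.val 1 1 = 1 := hN1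
    rwa [this, one_mul] at h1
  have s0 := congrFun (congrFun hinj 1) 0
  have s1 := congrFun (congrFun hinj 1) 1
  simp only [LowerRep.toMatrix, Matrix.mul_apply, Fin.sum_univ_two, Matrix.of_apply,
    Matrix.cons_val', Matrix.cons_val_zero, Matrix.cons_val_one, Matrix.cons_val_fin_one, e11,
    mul_zero, zero_add, one_mul] at s0 s1
  have hl : l = l' := by exact_mod_cast s1
  subst hl
  have hcc : c = c' := by
    have b1 := c.isLt
    have b2 := c'.isLt
    -- A nonzero entry would move c by at least k, out of [0, k).
    have hx : N.val 1 0 = 0 := by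
      by_contra hx
      rcases lt_or_gt_of_ne hx with hx | hx
      · nlinarith
      · nlinarith
    rw [hx, zero_mul, zero_add] at s0
    exact Fin.ext (by exact_mod_cast s0)
  subst hcc
  exact ⟨rfl, rfl⟩

/-! ### Upper triangular representatives and the bijection of cosets -/

theorem HeckeRep.det_eq (α : HeckeRep) : α.val.det = α.val 0 0 * α.val 1 1 := by
  rw [Matrix.det_fin_two, α.property.2.2.1, mul_zero, sub_zero]

theorem HeckeRep.det_pos (α : HeckeRep) : 0 < α.val.det := by
  rw [α.det_eq]
  exact mul_pos α.property.1 α.property.2.1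

/-- Every integer matrix with positive determinant is `σ α` with `σ ∈ SL₂(ℤ)`. -/
theorem exists_heckeRep {M : Matrix (Fin 2) (Fin 2) ℤ} (hM : 0 < M.det) :
    ∃ (σ : Matrix.SpecialLinearGroup (Fin 2) ℤ) (α : HeckeRep), M = σ.val * α.val := by
  let C : FixedDetMatrix (Fin 2) ℤ M.det → Prop := fun A =>
    ∃ (σ : Matrix.SpecialLinearGroup (Fin 2) ℤ) (α : HeckeRep), A.1 = σ.val * α.val
  -- Matrices of the form σα are stable under SL₂(ℤ), in particular under the two generators used by
  -- the reduction of fixed-determinant matrices. It then suffices to treat reduced matrices, which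
  -- are themselves representatives.
  have hstep : ∀ (τ : Matrix.SpecialLinearGroup (Fin 2) ℤ) B, C B → C (τ • B) := by
    rintro τ B ⟨σ, α, h⟩
    refine ⟨τ * σ, α, ?_⟩
    rw [FixedDetMatrices.smul_coe, h, Matrix.SpecialLinearGroup.coe_mul, mul_assoc]
  have key : C ⟨M, rfl⟩ := by
    refine FixedDetMatrices.induction_on (C := C) hM.ne' ?_ (hstep _) (hstep _)
    intro A h10 h00 h01 hlt
    have hd : A.1.det = M.det := A.2
    rw [Matrix.det_fin_two, h10, mul_zero, sub_zero] at hd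
    have h11 : 0 < A.1 1 1 := (mul_pos_iff_of_pos_left h00).1 (lt_of_lt_of_eq hM hd.symm)
    rw [abs_of_nonneg h01, abs_of_pos h11] at hlt
    exact ⟨1, ⟨A.1, h00, h11, h10, h01, hlt⟩, by simp⟩
  exact key

theorem heckeRep_unique {σ : Matrix.SpecialLinearGroup (Fin 2) ℤ} {α α' : HeckeRep}
    (h : σ.val * α.val = α'.val) : α = α' := by
  obtain ⟨A, ha, hd, hc, hb, hbd⟩ := α
  obtain ⟨A', ha', hd', hc', hb', hbd'⟩ := α'
  simp only at h
  have e00 := congrFun (congrFun h 0) 0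
  have e01 := congrFun (congrFun h 0) 1
  have e10 := congrFun (congrFun h 1) 0
  have e11 := congrFun (congrFun h 1) 1
  simp only [Matrix.mul_apply, Fin.sum_univ_two, hc, hc', mul_zero, add_zero] at e00 e01 e10 e11
  have s10 : σ.val 1 0 = 0 := by
    rcases mul_eq_zero.1 e10 with h | h
    · exact h
    · exact absurd h ha.ne'
  have hdet := σ.det_coe
  rw [Matrix.det_fin_two, s10, mul_zero, sub_zero] at hdet
  have s00 : σ.val 0 0 = 1 := by
    rcases Int.isUnit_iff.1 (IsUnit.of_mul_eq_one _ hdet) with h | h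
    · exact h
    · rw [h] at e00; linarith
  rw [s00, one_mul] at hdet
  rw [s10, hdet] at e11
  rw [s00] at e00 e01
  have s01 : σ.val 0 1 = 0 := by
    by_contra hx
    rcases lt_or_gt_of_ne hx with hx | hx <;> nlinarith
  rw [s01] at e01
  apply Subtype.ext
  ext i j
  fin_cases i <;> fin_cases j
  · simpa using e00
  · simpa using e01
  · exact hc.trans hc'.symm
  · simpa using e11

/-- The pairs `(p, α)` and `(q, β)` whose products `δ_p α` and `β δ_q` lie in the same coset of the
lower triangular subgroup of `SL₂(ℤ)`. -/
def SameCoset (x : PrimitivePair × HeckeRep) (y : PrimitivePair × LowerRep) : Prop :=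
  ∃ N : Matrix.SpecialLinearGroup (Fin 2) ℤ, N 0 1 = 0 ∧
    N.val * ((primitiveMatrix x.1).val * x.2.val) = y.2.toMatrix * (primitiveMatrix y.1).val

theorem exists_sameCoset_right (x : PrimitivePair × HeckeRep) : ∃ y, SameCoset x y := by
  obtain ⟨N, q, β, hN, h⟩ := exists_lowerRep (M := (primitiveMatrix x.1).val * x.2.val) (by
    rw [Matrix.det_mul, (primitiveMatrix x.1).det_coe, one_mul]
    exact x.2.det_pos)
  exact ⟨(q, β), N, hN, h⟩

theorem lower_inv (N : Matrix.SpecialLinearGroup (Fin 2) ℤ) (hN : N 0 1 = 0) : N⁻¹ 0 1 = 0 := by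
  have hN' : N.val 0 1 = 0 := hN
  simp [Matrix.SpecialLinearGroup.SL2_inv_expl, hN']

theorem lower_mul (N N' : Matrix.SpecialLinearGroup (Fin 2) ℤ) (hN : N 0 1 = 0)
    (hN' : N' 0 1 = 0) : (N * N') 0 1 = 0 := by
  have h : N.val 0 1 = 0 := hN
  have h' : N'.val 0 1 = 0 := hN'
  change (N.val * N'.val) 0 1 = 0
  simp [Matrix.mul_apply, Fin.sum_univ_two, h, h']

theorem SpecialLinearGroup.inv_mul_cancel_left_val (N : Matrix.SpecialLinearGroup (Fin 2) ℤ)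
    (A : Matrix (Fin 2) (Fin 2) ℤ) : N⁻¹.val * (N.val * A) = A := by
  rw [← mul_assoc, ← Matrix.SpecialLinearGroup.coe_mul, inv_mul_cancel,
    Matrix.SpecialLinearGroup.coe_one, one_mul]

theorem sameCoset_right_unique {x : PrimitivePair × HeckeRep} {y y' : PrimitivePair × LowerRep}
    (h : SameCoset x y) (h' : SameCoset x y') : y = y' := by
  obtain ⟨N, hN, e⟩ := h
  obtain ⟨N', hN', e'⟩ := h'
  have hu := lowerRep_unique (N := N' * N⁻¹) (q := y.1) (q' := y'.1) (β := y.2) (β' := y'.2)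
    (lower_mul _ _ hN' (lower_inv _ hN)) (by
      rw [← e, ← e', Matrix.SpecialLinearGroup.coe_mul, mul_assoc,
        SpecialLinearGroup.inv_mul_cancel_left_val])
  exact Prod.ext hu.1 hu.2

/-- In determinant one, kl = 1 forces β to be the identity. -/
theorem exists_lower_mul_primitiveMatrix (σ : Matrix.SpecialLinearGroup (Fin 2) ℤ) :
    ∃ (p : PrimitivePair) (N : Matrix.SpecialLinearGroup (Fin 2) ℤ),
      N 0 1 = 0 ∧ N * σ = primitiveMatrix p := by
  obtain ⟨N, q, β, hN, h⟩ := exists_lowerRep (M := σ.val) (by rw [σ.det_coe]; exact one_pos)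
  have hdet := congrArg Matrix.det h
  rw [Matrix.det_mul, Matrix.det_mul, N.det_coe, σ.det_coe, (primitiveMatrix q).det_coe, mul_one,
    mul_one] at hdet
  obtain ⟨k, c, l⟩ := β
  simp only [LowerRep.toMatrix, Matrix.det_fin_two_of, zero_mul, sub_zero] at hdet
  have hkl : (k : ℕ) * (l : ℕ) = 1 := by exact_mod_cast hdet.symm
  have hk := Nat.eq_one_of_mul_eq_one_right hkl
  have hl := Nat.eq_one_of_mul_eq_one_left hkl
  have hc : (c : ℕ) = 0 := by have := c.isLt; omega
  refine ⟨q, N, hN, Subtype.ext ?_⟩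
  rw [Matrix.SpecialLinearGroup.coe_mul, h]
  have : LowerRep.toMatrix ⟨k, c, l⟩ = 1 := by
    simp [LowerRep.toMatrix, hk, hl, hc, Matrix.one_fin_two]
  rw [this, one_mul]

/-- Write βδ_q = σα with σ in SL₂(ℤ), then replace σ by the δ_p in its coset. -/
theorem exists_sameCoset_left (y : PrimitivePair × LowerRep) : ∃ x, SameCoset x y := by
  obtain ⟨σ, α, h⟩ := exists_heckeRep (M := y.2.toMatrix * (primitiveMatrix y.1).val) (by
    rw [Matrix.det_mul, (primitiveMatrix y.1).det_coe, mul_one, LowerRep.toMatrix,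
      Matrix.det_fin_two_of]
    simp)
  obtain ⟨p, N, hN, e⟩ := exists_lower_mul_primitiveMatrix σ
  refine ⟨(p, α), N⁻¹, lower_inv _ hN, ?_⟩
  simp only
  rw [h, ← e, Matrix.SpecialLinearGroup.coe_mul, mul_assoc,
    SpecialLinearGroup.inv_mul_cancel_left_val]

/-- The two products lie in one SL₂(ℤ)-coset, which determines α; once α is cancelled, uniqueness
with β = 1 determines p. -/
theorem sameCoset_left_unique {x x' : PrimitivePair × HeckeRep} {y : PrimitivePair × LowerRep}
    (h : SameCoset x y) (h' : SameCoset x' y) : x = x' := by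
  obtain ⟨p, α⟩ := x
  obtain ⟨p', α'⟩ := x'
  obtain ⟨N, hN, e⟩ := h
  obtain ⟨N', hN', e'⟩ := h'
  simp only at e e'
  have hα : α = α' := by
    apply heckeRep_unique (σ := (primitiveMatrix p')⁻¹ * (N'⁻¹ * (N * primitiveMatrix p)))
    rw [Matrix.SpecialLinearGroup.coe_mul, Matrix.SpecialLinearGroup.coe_mul,
      Matrix.SpecialLinearGroup.coe_mul, mul_assoc, mul_assoc, mul_assoc, e, ← e',
      SpecialLinearGroup.inv_mul_cancel_left_val, SpecialLinearGroup.inv_mul_cancel_left_val]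
  subst hα
  have hp : N.val * (primitiveMatrix p).val = N'.val * (primitiveMatrix p').val := by
    have h := e.trans e'.symm
    rw [← mul_assoc, ← mul_assoc] at h
    -- α need not be invertible over ℤ; its adjugate reduces it to the nonzero scalar det α.
    have h2 := congrArg (· * α.val.adjugate) h
    simp only [mul_assoc, Matrix.mul_adjugate, Matrix.mul_smul, mul_one] at h2
    exact smul_right_injective _ α.det_pos.ne' h2
  have hu := lowerRep_unique (N := N'⁻¹ * N) (q := p) (q' := p')
    (β := ⟨1, 0, 1⟩) (β' := ⟨1, 0, 1⟩) (lower_mul _ _ (lower_inv _ hN') hN) (by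
      have h1 : LowerRep.toMatrix ⟨1, 0, 1⟩ = 1 := by
        simp [LowerRep.toMatrix, Matrix.one_fin_two]
      rw [h1, one_mul, one_mul, Matrix.SpecialLinearGroup.coe_mul, mul_assoc, hp,
        SpecialLinearGroup.inv_mul_cancel_left_val])
  rw [hu.1]

/-- The bijection between the pairs `(p, α)` and `(q, β)` with `δ_p α` and `β δ_q` in the same
coset of the lower triangular subgroup. -/
def cosetEquiv : PrimitivePair × HeckeRep ≃ PrimitivePair × LowerRep :=
  Equiv.ofBijective (fun x => (exists_sameCoset_right x).choose)
    ⟨fun x x' h => sameCoset_left_unique (exists_sameCoset_right x).choose_spec (by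
        simp only at h
        rw [h]
        exact (exists_sameCoset_right x').choose_spec),
      fun y => by
        obtain ⟨x, hx⟩ := exists_sameCoset_left y
        exact ⟨x, sameCoset_right_unique (exists_sameCoset_right x).choose_spec hx⟩⟩

theorem sameCoset_cosetEquiv (x : PrimitivePair × HeckeRep) : SameCoset x (cosetEquiv x) :=
  (exists_sameCoset_right x).choose_spec

theorem SameCoset.det_eq {x : PrimitivePair × HeckeRep} {y : PrimitivePair × LowerRep}
    (h : SameCoset x y) : x.2.val.det = ((y.2.1 : ℕ) : ℤ) * ((y.2.2.2 : ℕ) : ℤ) := by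
  obtain ⟨N, -, e⟩ := h
  have hdet := congrArg Matrix.det e
  rw [Matrix.det_mul, Matrix.det_mul, Matrix.det_mul, N.det_coe, (primitiveMatrix x.1).det_coe,
    (primitiveMatrix y.1).det_coe, one_mul, one_mul, mul_one, LowerRep.toMatrix,
    Matrix.det_fin_two_of, zero_mul, sub_zero] at hdet
  exact hdet

/-- A lower triangular element of SL₂(ℤ) changes the first row only by a sign. With the determinant,
this is all that the summand sees. -/
theorem SameCoset.row_eq {x : PrimitivePair × HeckeRep} {y : PrimitivePair × LowerRep}
    (h : SameCoset x y) : ∃ e : ℤ, e * e = 1 ∧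
      ((primitiveMatrix x.1).val * x.2.val) 0 0 = e * (((y.2.1 : ℕ) : ℤ) * y.1.val.1) ∧
      ((primitiveMatrix x.1).val * x.2.val) 0 1 = e * (((y.2.1 : ℕ) : ℤ) * y.1.val.2) := by
  obtain ⟨N, hN, e⟩ := h
  have h1 := SpecialLinearGroup.mul_eq_one_of_lower N hN
  have hN' : N.val 0 1 = 0 := hN
  have hee : N.val 0 0 * N.val 0 0 = 1 := by
    rcases Int.isUnit_iff.1 (IsUnit.of_mul_eq_one _ h1) with h | h
    · have : N.val 0 0 = 1 := h
      rw [this, one_mul]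
    · have : N.val 0 0 = -1 := h
      rw [this]; norm_num
  have r0 := congrFun (congrFun e 0) 0
  have r1 := congrFun (congrFun e 0) 1
  rw [Matrix.mul_apply, Fin.sum_univ_two, hN', zero_mul, add_zero] at r0 r1
  refine ⟨N.val 0 0, hee, ?_, ?_⟩
  · have q : (y.2.toMatrix * (primitiveMatrix y.1).val) 0 0 =
        ((y.2.1 : ℕ) : ℤ) * y.1.val.1 := by
      simp [LowerRep.toMatrix, Matrix.mul_apply, Fin.sum_univ_two, primitiveMatrix]
    rw [← q, ← r0, ← mul_assoc, hee, one_mul]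
  · have q : (y.2.toMatrix * (primitiveMatrix y.1).val) 0 1 =
        ((y.2.1 : ℕ) : ℤ) * y.1.val.2 := by
      simp [LowerRep.toMatrix, Matrix.mul_apply, Fin.sum_univ_two, primitiveMatrix]
    rw [← q, ← r1, ← mul_assoc, hee, one_mul]

/-! ### Convergence of the Eisenstein series -/

theorem exists_pos_mul_sq_le {a b c d : ℝ} (h : a * d - b * c ≠ 0) :
    ∃ κ : ℝ, 0 < κ ∧ ∀ x y : ℝ, κ * (x ^ 2 + y ^ 2) ≤
      (x * a + y * c) ^ 2 + (x * b + y * d) ^ 2 := by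
  have hF : 0 < a ^ 2 + b ^ 2 + c ^ 2 + d ^ 2 := by
    by_contra hF
    have ha : a = 0 := by nlinarith [sq_nonneg a, sq_nonneg b, sq_nonneg c, sq_nonneg d]
    have hb : b = 0 := by nlinarith [sq_nonneg a, sq_nonneg b, sq_nonneg c, sq_nonneg d]
    simp [ha, hb] at h
  -- The inverse square of the Frobenius norm of the inverse matrix. The bound recovers (x, y) from
  -- its image by the adjugate and then applies Cauchy–Schwarz.
  refine ⟨(a * d - b * c) ^ 2 / (a ^ 2 + b ^ 2 + c ^ 2 + d ^ 2), by positivity, fun x y => ?_⟩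
  rw [div_mul_eq_mul_div, div_le_iff₀ hF]
  set X := x * a + y * c with hX
  set Y := x * b + y * d with hY
  have e : (a * d - b * c) ^ 2 * (x ^ 2 + y ^ 2) = (d * X - c * Y) ^ 2 + (a * Y - b * X) ^ 2 := by
    rw [hX, hY]; ring
  rw [e]
  nlinarith [sq_nonneg (d * Y + c * X), sq_nonneg (a * X + b * Y)]

/-- The quadratic form `|(x, y) g|²`. -/
def rowForm (g : GL (Fin 2) ℝ) (x y : ℝ) : ℝ :=
  (x * g 0 0 + y * g 1 0) ^ 2 + (x * g 0 1 + y * g 1 1) ^ 2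

theorem exists_pos_mul_le_rowForm (g : GL (Fin 2) ℝ) :
    ∃ κ : ℝ, 0 < κ ∧ ∀ x y : ℝ, κ * (x ^ 2 + y ^ 2) ≤ rowForm g x y := by
  have h := det_ne_zero g
  rw [Matrix.det_fin_two] at h
  exact exists_pos_mul_sq_le h

theorem rowForm_pos (g : GL (Fin 2) ℝ) {x y : ℝ} (h : x ≠ 0 ∨ y ≠ 0) : 0 < rowForm g x y := by
  obtain ⟨κ, hκ, hle⟩ := exists_pos_mul_le_rowForm g
  refine lt_of_lt_of_le (mul_pos hκ ?_) (hle x y)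
  rcases h with h | h <;> positivity

theorem PrimitivePair.ne_zero (p : PrimitivePair) : p.val.1 ≠ 0 ∨ p.val.2 ≠ 0 := by
  rcases p.property.2 with h | h
  · exact Or.inl h.ne'
  · exact Or.inr h.2.ne'

theorem PrimitivePair.rowForm_pos (g : GL (Fin 2) ℝ) (p : PrimitivePair) :
    0 < rowForm g p.val.1 p.val.2 :=
  HeckeBaxter.rowForm_pos g (by exact_mod_cast p.ne_zero)

/-- The form dominates a multiple of the squared sup norm, so the series is compared with the sum of
‖v‖^{2r} over ℤ², whose exponent of decay -2r exceeds 2. -/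
theorem summable_rowForm_rpow (g : GL (Fin 2) ℝ) {r : ℝ} (hr : r < -1) :
    Summable fun p : PrimitivePair => rowForm g p.val.1 p.val.2 ^ r := by
  obtain ⟨κ, hκ, hle⟩ := exists_pos_mul_le_rowForm g
  have hinj : Function.Injective fun p : PrimitivePair => (![p.val.1, p.val.2] : Fin 2 → ℤ) := by
    intro p q h
    have h0 := congrFun h 0
    have h1 := congrFun h 1
    exact Subtype.ext (Prod.ext h0 h1)
  have hs := ((EisensteinSeries.summable_one_div_norm_rpow (k := -2 * r) (by linarith)).comp_injective
    hinj).mul_left (κ ^ r)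
  refine Summable.of_nonneg_of_le (fun p => Real.rpow_nonneg (p.rowForm_pos g).le _)
    (fun p => ?_) hs
  set v : Fin 2 → ℤ := ![p.val.1, p.val.2] with hv
  have hn0 : 0 < ‖v‖ := by
    rw [norm_pos_iff]
    intro h
    have h0 := congrFun h 0
    have h1 := congrFun h 1
    rcases p.ne_zero with h | h
    · exact h h0
    · exact h h1
  have hsq : ‖v‖ ^ 2 ≤ (p.val.1 : ℝ) ^ 2 + (p.val.2 : ℝ) ^ 2 := by
    rw [EisensteinSeries.norm_eq_max_natAbs]
    have e0 : (((v 0).natAbs : ℕ) : ℝ) ^ 2 = (p.val.1 : ℝ) ^ 2 := by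
      rw [Nat.cast_natAbs, Int.cast_abs, sq_abs]; rfl
    have e1 : (((v 1).natAbs : ℕ) : ℝ) ^ 2 = (p.val.2 : ℝ) ^ 2 := by
      rw [Nat.cast_natAbs, Int.cast_abs, sq_abs]; rfl
    rcases max_choice (v 0).natAbs (v 1).natAbs with h | h
    · rw [h, e0]; nlinarith [sq_nonneg (p.val.2 : ℝ)]
    · rw [h, e1]; nlinarith [sq_nonneg (p.val.1 : ℝ)]
  have hlow : κ * ‖v‖ ^ 2 ≤ rowForm g p.val.1 p.val.2 :=
    (mul_le_mul_of_nonneg_left hsq hκ.le).trans (hle _ _)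
  calc rowForm g p.val.1 p.val.2 ^ r ≤ (κ * ‖v‖ ^ 2) ^ r :=
        Real.rpow_le_rpow_of_nonpos (by positivity) hlow (by linarith)
    _ = κ ^ r * ‖v‖ ^ (-(-2 * r)) := by
        rw [Real.mul_rpow hκ.le (by positivity), ← Real.rpow_two, ← Real.rpow_mul (norm_nonneg _)]
        congr 2
        ring

theorem eisensteinTerm_eq_rowForm (γ : Fin 2 → ℂ) (g : GL (Fin 2) ℝ) (p : PrimitivePair) :
    eisensteinTerm γ g p = ((|g.val.det| : ℝ) : ℂ) ^ (Complex.I * γ 1 + 1 / 2) *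
      ((rowForm g p.val.1 p.val.2 : ℝ) : ℂ) ^ ((Complex.I * (γ 0 - γ 1) - 1) / 2) := rfl

theorem summable_eisensteinTerm {γ : Fin 2 → ℂ} (hγ : 1 < (γ 0 - γ 1).im) (g : GL (Fin 2) ℝ) :
    Summable (eisensteinTerm γ g) := by
  have hr : ((Complex.I * (γ 0 - γ 1) - 1) / 2).re < -1 := by
    have : ((Complex.I * (γ 0 - γ 1) - 1) / 2).re = (-(γ 0 - γ 1).im - 1) / 2 := by
      simp
    rw [this]
    linarith
  refine Summable.mul_left _ ?_
  refine Summable.of_norm ((summable_rowForm_rpow g hr).congr fun p => ?_)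
  exact (Complex.norm_cpow_eq_rpow_re_of_pos (p.rowForm_pos g) _).symm

theorem eisensteinTerm_eq_sphericalFun (γ : Fin 2 → ℂ) (g : GL (Fin 2) ℝ) (p : PrimitivePair) :
    eisensteinTerm γ g p =
      sphericalFun γ (Matrix.SpecialLinearGroup.mapGL ℝ (primitiveMatrix p) * g) := by
  set K : GL (Fin 2) ℝ := Matrix.SpecialLinearGroup.mapGL ℝ (primitiveMatrix p) with hK
  have K00 : K 0 0 = p.val.1 := (primitiveMatrix_row p).1
  have K01 : K 0 1 = p.val.2 := (primitiveMatrix_row p).2.1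
  have Kd : K.val.det = 1 := (primitiveMatrix_row p).2.2
  simp only [sphericalFun, eisensteinTerm]
  rw [Matrix.GeneralLinearGroup.coe_mul, Matrix.det_mul, Kd, one_mul, Matrix.mul_apply,
    Matrix.mul_apply, Fin.sum_univ_two, Fin.sum_univ_two, K00, K01]

/-! ### The kernel as a sum of translates -/

theorem HeckeRep.det_map (α : HeckeRep) :
    (α.val.map (Int.cast : ℤ → ℝ)).det = (α.val.det : ℝ) := by
  rw [Matrix.det_fin_two, Matrix.det_fin_two]
  simp

/-- A Hecke representative as an element of `GL₂(ℝ)`. -/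
def HeckeRep.toGL (α : HeckeRep) : GL (Fin 2) ℝ :=
  Matrix.GeneralLinearGroup.mkOfDetNeZero (α.val.map (Int.cast : ℤ → ℝ)) (by
    rw [α.det_map]
    exact_mod_cast α.det_pos.ne')

theorem HeckeRep.toGL_val (α : HeckeRep) : α.toGL.val = α.val.map (Int.cast : ℤ → ℝ) := rfl

theorem HeckeRep.det_toGL (α : HeckeRep) : α.toGL.val.det = (α.val.det : ℝ) := α.det_map

/-- Cyclicity of the trace: the exponent is the squared Frobenius norm of hαg. -/
theorem heckeGaussian_eq_gaussian (g h : GL (Fin 2) ℝ) (α : HeckeRep) :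
    heckeGaussian g h α = gaussian (entries (h * (α.toGL * g))) := by
  have e : Matrix.trace (h.val.transpose * h.val * (α.val.map (Int.cast : ℤ → ℝ) * g.val *
      g.val.transpose * (α.val.map (Int.cast : ℤ → ℝ)).transpose)) =
      Matrix.trace ((h * (α.toGL * g)).val * (h * (α.toGL * g)).val.transpose) := by
    simp only [Matrix.GeneralLinearGroup.coe_mul, HeckeRep.toGL_val, Matrix.transpose_mul]
    rw [mul_assoc h.val.transpose, Matrix.trace_mul_comm]
    simp only [mul_assoc]
  rw [heckeGaussian, e, gaussian]
  congr 2
  simp only [Matrix.trace_fin_two, Matrix.mul_apply, Fin.sum_univ_two, Matrix.transpose_apply,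
    entries]
  ring

theorem sum_sq_mul_right (h g : GL (Fin 2) ℝ) (i : Fin 2) :
    (h * g) i 0 ^ 2 + (h * g) i 1 ^ 2 = rowForm g (h i 0) (h i 1) := by
  rw [Matrix.GeneralLinearGroup.coe_mul, Matrix.mul_apply, Matrix.mul_apply, Fin.sum_univ_two,
    Fin.sum_univ_two]
  rfl

/-- The lower bound for quadratic forms is applied twice, to the rows acted on by g and to the
columns acted on by h. -/
theorem exists_pos_mul_le_sum_sq (g h : GL (Fin 2) ℝ) :
    ∃ κ : ℝ, 0 < κ ∧ ∀ α : HeckeRep,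
      gaussian (entries (h * (α.toGL * g))) ≤
        Real.exp (-(κ * ((α.val 0 0 : ℝ) ^ 2 + (α.val 0 1 : ℝ) ^ 2 + (α.val 1 1 : ℝ) ^ 2))) := by
  obtain ⟨κ, hκ, h1⟩ := exists_pos_mul_le_rowForm g
  have hd : h 0 0 * h 1 1 - h 1 0 * h 0 1 ≠ 0 := by
    have := det_ne_zero h
    rw [Matrix.det_fin_two] at this
    rwa [mul_comm (h 1 0)]
  obtain ⟨κ', hκ', h2⟩ := exists_pos_mul_sq_le hd
  refine ⟨Real.pi * (κ * κ'), by positivity, fun α => ?_⟩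
  unfold gaussian
  apply Real.exp_le_exp.2
  have hpi := Real.pi_pos
  rw [neg_mul, neg_le_neg_iff, mul_assoc]
  refine mul_le_mul_of_nonneg_left ?_ hpi.le
  have e : ∀ i, (h * (α.toGL * g)) i 0 ^ 2 + (h * (α.toGL * g)) i 1 ^ 2 =
      rowForm g ((h * α.toGL) i 0) ((h * α.toGL) i 1) := by
    intro i
    rw [← mul_assoc, sum_sq_mul_right]
  have r0 := (h1 ((h * α.toGL) 0 0) ((h * α.toGL) 0 1)).trans_eq (e 0).symm
  have r1 := (h1 ((h * α.toGL) 1 0) ((h * α.toGL) 1 1)).trans_eq (e 1).symm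
  have c : ∀ j, κ' * ((α.val 0 j : ℝ) ^ 2 + (α.val 1 j : ℝ) ^ 2) ≤
      (h * α.toGL) 0 j ^ 2 + (h * α.toGL) 1 j ^ 2 := by
    intro j
    refine (h2 (α.val 0 j) (α.val 1 j)).trans_eq ?_
    rw [Matrix.GeneralLinearGroup.coe_mul, Matrix.mul_apply, Matrix.mul_apply, Fin.sum_univ_two,
      Fin.sum_univ_two, HeckeRep.toGL_val]
    simp only [Matrix.map_apply]
    ring
  have c0 := mul_le_mul_of_nonneg_left (c 0) hκ.le
  have c1 := mul_le_mul_of_nonneg_left (c 1) hκ.le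
  have h10 : (α.val 1 0 : ℝ) = 0 := by exact_mod_cast α.property.2.2.1
  rw [h10] at c0
  simp only [entries]
  linarith

theorem summable_heckeGaussian (g h : GL (Fin 2) ℝ) : Summable (heckeGaussian g h) := by
  obtain ⟨κ, hκ, hle⟩ := exists_pos_mul_le_sum_sq g h
  set r := Real.exp (-κ) with hr
  have hr0 : 0 ≤ r := (Real.exp_pos _).le
  have hr1 : r < 1 := by
    rw [hr, ← Real.exp_zero]; exact Real.exp_lt_exp.2 (by linarith)
  have hg := summable_geometric_of_lt_one hr0 hr1
  have hs : Summable fun n : ℕ × ℕ × ℕ => r ^ n.1 * (r ^ n.2.1 * r ^ n.2.2) :=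
    hg.mul_of_nonneg (hg.mul_of_nonneg hg (fun _ => pow_nonneg hr0 _) (fun _ => pow_nonneg hr0 _))
      (fun _ => pow_nonneg hr0 _) (fun _ => mul_nonneg (pow_nonneg hr0 _) (pow_nonneg hr0 _))
  let ι : HeckeRep → ℕ × ℕ × ℕ := fun α =>
    ((α.val 0 0).toNat, (α.val 0 1).toNat, (α.val 1 1).toNat)
  have hι : Function.Injective ι := by
    intro α α' h
    have p := α.property
    have p' := α'.property
    simp only [ι, Prod.mk.injEq] at h
    apply Subtype.ext
    ext i j
    fin_cases i <;> fin_cases j <;> simp only [Fin.zero_eta, Fin.mk_one, Fin.isValue] <;> omega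
  refine Summable.of_nonneg_of_le (fun α => (Real.exp_pos _).le) (fun α => ?_)
    (hs.comp_injective hι)
  rw [heckeGaussian_eq_gaussian]
  refine (hle α).trans ?_
  -- Since n ≤ n² for integers, the Gaussian in the three entries is bounded by a product of three
  -- geometric terms.
  have key : ∀ n : ℤ, 0 ≤ n → ((n.toNat : ℕ) : ℝ) ≤ (n : ℝ) ^ 2 := by
    intro n hn
    have h1 : ((n.toNat : ℕ) : ℤ) ≤ n ^ 2 := by
      rw [Int.toNat_of_nonneg hn]; nlinarith
    exact_mod_cast h1
  simp only [Function.comp, ι, hr]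
  rw [← Real.exp_nat_mul, ← Real.exp_nat_mul, ← Real.exp_nat_mul, ← Real.exp_add, ← Real.exp_add]
  apply Real.exp_le_exp.2
  have a1 := mul_le_mul_of_nonneg_left (key _ α.property.1.le) hκ.le
  have a2 := mul_le_mul_of_nonneg_left (key _ α.property.2.2.2.1) hκ.le
  have a3 := mul_le_mul_of_nonneg_left (key _ α.property.2.1.le) hκ.le
  linarith

/-! ### The Dirichlet series -/

theorem hasSum_pnat_cpow {z : ℂ} (hz : 1 < z.re) :
    HasSum (fun n : ℕ+ => (((n : ℕ) : ℝ) : ℂ) ^ (-z)) (riemannZeta z) := by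
  have hs : Summable fun n : ℕ => 1 / (n : ℂ) ^ z := Complex.summable_one_div_nat_cpow.2 hz
  have h := hs.hasSum
  rw [← zeta_eq_tsum_one_div_nat_cpow hz] at h
  have hinj : Function.Injective ((↑) : ℕ+ → ℕ) := PNat.coe_injective
  have h0 : ∀ n : ℕ, n ∉ Set.range ((↑) : ℕ+ → ℕ) → 1 / (n : ℂ) ^ z = 0 := by
    intro n hn
    have : n = 0 := by
      by_contra h
      exact hn ⟨⟨n, Nat.pos_of_ne_zero h⟩, rfl⟩
    subst this
    have hz0 : z ≠ 0 := by
      rintro rfl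
      simp at hz
      linarith
    simp [Complex.zero_cpow hz0]
  convert! (hinj.hasSum_iff h0).2 h using 2 with n
  simp [Complex.cpow_neg]

/-- The weight of the coset of `(k 0; c l)` in the Dirichlet series. -/
def lowerWeight (z₁ z₂ : ℂ) (β : LowerRep) : ℂ :=
  (((β.1 : ℕ) : ℝ) : ℂ) ^ (-z₁ - 1) * (((β.2.2 : ℕ) : ℝ) : ℂ) ^ (-z₂)

/-- Stated over a general field because it serves both for the complex series and for the series of
its norms. -/
theorem hasSum_fin_prod {R : Type*} [NormedField R] [CompleteSpace R] (c : R) {f : ℕ+ → R} {a : R}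
    (k : ℕ) (hf : HasSum f a) (hf' : Summable fun n => ‖f n‖) :
    HasSum (fun x : Fin k × ℕ+ => c * f x.2) (k * c * a) := by
  have h1 : HasSum (fun _ : Fin k => c) (k * c) := by
    simpa using hasSum_fintype fun _ : Fin k => c
  exact h1.mul hf (summable_mul_of_summable_norm (f := fun _ : Fin k => c)
    (hasSum_fintype fun _ : Fin k => ‖c‖).summable hf')

/-- The weight does not involve c, so the k residues turn k^{-z₁-1} into k^{-z₁} and the two zeta
series separate. -/
theorem hasSum_lowerWeight {z₁ z₂ : ℂ} (h₁ : 1 < z₁.re) (h₂ : 1 < z₂.re) :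
    HasSum (lowerWeight z₁ z₂) (riemannZeta z₁ * riemannZeta z₂) := by
  have s1 := hasSum_pnat_cpow h₁
  have s2 := hasSum_pnat_cpow h₂
  have n2 := s2.summable.norm
  have hk : ∀ k : ℕ+, (((k : ℕ) : ℝ) : ℂ) * (((k : ℕ) : ℝ) : ℂ) ^ (-z₁ - 1) =
      (((k : ℕ) : ℝ) : ℂ) ^ (-z₁) := by
    intro k
    have hk0 : (((k : ℕ) : ℝ) : ℂ) ≠ 0 := by simp
    rw [Complex.cpow_sub _ _ hk0, Complex.cpow_one]
    field_simp
  refine HasSum.sigma_of_hasSum (s1.mul_right _) (fun k => ?_) ?_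
  · have h := hasSum_fin_prod ((((k : ℕ) : ℝ) : ℂ) ^ (-z₁ - 1)) (k : ℕ) s2 n2
    rw [← Complex.ofReal_natCast, hk] at h
    exact h
  · rw [← summable_norm_iff, summable_sigma_of_nonneg fun _ => norm_nonneg _]
    have hf : ∀ k : ℕ+, HasSum (fun x : Fin k × ℕ+ => ‖lowerWeight z₁ z₂ ⟨k, x⟩‖)
        (‖(((k : ℕ) : ℝ) : ℂ) ^ (-z₁)‖ * ∑' n : ℕ+, ‖(((n : ℕ) : ℝ) : ℂ) ^ (-z₂)‖) := by
      intro k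
      have h := hasSum_fin_prod ‖(((k : ℕ) : ℝ) : ℂ) ^ (-z₁ - 1)‖ (k : ℕ) n2.hasSum
        (by simpa using n2)
      rw [← hk, norm_mul, Complex.norm_real, Real.norm_natCast]
      simp only [lowerWeight, norm_mul]
      exact h
    exact ⟨fun k => (hf k).summable, by
      simp_rw [fun k => (hf k).tsum_eq]
      exact s1.summable.norm.mul_right _⟩

/-! ### Hecke translates of the Eisenstein series -/

/-- The term of index `(p, α)` of the Dirichlet series of Hecke translates of the Eisenstein
series. -/
def heckeTerm (γ : Fin 2 → ℂ) (s : ℂ) (g : GL (Fin 2) ℝ) (x : PrimitivePair × HeckeRep) : ℂ :=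
  ((|x.2.toGL.val.det| : ℝ) : ℂ) ^ (-(s + 1 / 2)) * eisensteinTerm γ (x.2.toGL * g) x.1

theorem rowForm_toGL_mul (g : GL (Fin 2) ℝ) (p : PrimitivePair) (α : HeckeRep) :
    rowForm (α.toGL * g) p.val.1 p.val.2 =
      rowForm g (((primitiveMatrix p).val * α.val) 0 0) (((primitiveMatrix p).val * α.val) 0 1) := by
  unfold rowForm
  simp only [Matrix.GeneralLinearGroup.coe_mul, HeckeRep.toGL_val, Matrix.mul_apply,
    Fin.sum_univ_two, Matrix.map_apply, primitiveMatrix, Matrix.of_apply, Matrix.cons_val',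
    Matrix.cons_val_zero, Matrix.cons_val_one, Matrix.cons_val_fin_one]
  push_cast
  ring

/-- In terms of the representative βδ_q of the same coset, det α = kl and the first row is ±k times
q; the summand thus splits into a factor from q and a factor from β. -/
theorem heckeTerm_eq (γ : Fin 2 → ℂ) (s : ℂ) (g : GL (Fin 2) ℝ) (x : PrimitivePair × HeckeRep) :
    heckeTerm γ s g x = eisensteinTerm γ g (cosetEquiv x).1 *
      lowerWeight (s - Complex.I * γ 0) (s - Complex.I * γ 1) (cosetEquiv x).2 := by
  have hx := sameCoset_cosetEquiv x
  obtain ⟨p, α⟩ := x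
  generalize cosetEquiv (p, α) = y at hx ⊢
  obtain ⟨q, k, c, l⟩ := y
  have hdet := hx.det_eq
  obtain ⟨e, he, r0, r1⟩ := hx.row_eq
  simp only at hdet r0 r1 ⊢
  have hk : (0 : ℝ) < ((k : ℕ) : ℝ) := by simp
  have hl : (0 : ℝ) < ((l : ℕ) : ℝ) := by simp
  have hkc : (((k : ℕ) : ℝ) : ℂ) ≠ 0 := by exact_mod_cast hk.ne'
  have hlc : (((l : ℕ) : ℝ) : ℂ) ≠ 0 := by exact_mod_cast hl.ne'
  have hdetR : |α.toGL.val.det| = ((k : ℕ) : ℝ) * ((l : ℕ) : ℝ) := by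
    rw [α.det_toGL, hdet]
    push_cast
    exact abs_of_pos (mul_pos hk hl)
  have heR : (e : ℝ) * e = 1 := by exact_mod_cast he
  have hrow : rowForm (α.toGL * g) p.val.1 p.val.2 =
      ((k : ℕ) : ℝ) ^ 2 * rowForm g q.val.1 q.val.2 := by
    rw [rowForm_toGL_mul, r0, r1]
    unfold rowForm
    push_cast
    linear_combination ((((k : ℕ) : ℝ) * (q.val.1 * g 0 0 + q.val.2 * g 1 0)) ^ 2 +
      (((k : ℕ) : ℝ) * (q.val.1 * g 0 1 + q.val.2 * g 1 1)) ^ 2) * heR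
  rw [heckeTerm, eisensteinTerm_eq_rowForm, eisensteinTerm_eq_rowForm, lowerWeight]
  simp only
  rw [hrow, Matrix.GeneralLinearGroup.coe_mul, Matrix.det_mul, abs_mul, hdetR,
    Complex.ofReal_mul (_ * _), Complex.ofReal_mul ((k : ℕ) : ℝ), Complex.ofReal_mul (_ ^ 2),
    ← Complex.ofReal_mul ((k : ℕ) : ℝ),
    Complex.mul_cpow_ofReal_nonneg (mul_pos hk hl).le (abs_nonneg _), Complex.ofReal_mul,
    Complex.mul_cpow_ofReal_nonneg hk.le hl.le, Complex.mul_cpow_ofReal_nonneg hk.le hl.le,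
    Complex.mul_cpow_ofReal_nonneg (sq_nonneg _) (q.rowForm_pos g).le, ofReal_sq_cpow hk]
  have ek : (((k : ℕ) : ℝ) : ℂ) ^ (-(s - Complex.I * γ 0) - 1) =
      (((k : ℕ) : ℝ) : ℂ) ^ (-(s + 1 / 2)) * (((k : ℕ) : ℝ) : ℂ) ^ (Complex.I * γ 1 + 1 / 2) *
      (((k : ℕ) : ℝ) : ℂ) ^ (2 * ((Complex.I * (γ 0 - γ 1) - 1) / 2)) := by
    rw [← Complex.cpow_add _ _ hkc, ← Complex.cpow_add _ _ hkc]
    congr 1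
    ring
  have el : (((l : ℕ) : ℝ) : ℂ) ^ (-(s - Complex.I * γ 1)) =
      (((l : ℕ) : ℝ) : ℂ) ^ (-(s + 1 / 2)) *
      (((l : ℕ) : ℝ) : ℂ) ^ (Complex.I * γ 1 + 1 / 2) := by
    rw [← Complex.cpow_add _ _ hlc]
    congr 1
    ring
  rw [ek, el]
  ring

theorem hasSum_heckeTerm {γ : Fin 2 → ℂ} {s : ℂ} (hγ : 1 < (γ 0 - γ 1).im)
    (hs : ∀ j, 1 < (s - Complex.I * γ j).re) (g : GL (Fin 2) ℝ) :
    HasSum (heckeTerm γ s g) (eisenstein γ g *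
      (riemannZeta (s - Complex.I * γ 0) * riemannZeta (s - Complex.I * γ 1))) := by
  have h1 := summable_eisensteinTerm hγ g
  have h2 := hasSum_lowerWeight (hs 0) (hs 1)
  have h := h1.hasSum.mul h2 (summable_mul_of_summable_norm h1.norm h2.summable.norm)
  rw [← eisenstein_eq_tsum] at h
  rw [funext (heckeTerm_eq γ s g)]
  exact cosetEquiv.hasSum_iff.2 h

/-! ### Exchange of sum and integral -/

/-- The sum of a series of functions whose `L¹` norms are summable is integrable. -/
theorem integrable_tsum_of_summable_integral_norm {X ι : Type*} [MeasurableSpace X]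
    {μ : Measure X} [Countable ι] {F : ι → X → ℂ} (hF : ∀ i, Integrable (F i) μ)
    (hs : Summable fun i => ∫ a, ‖F i a‖ ∂μ) : Integrable (fun a => ∑' i, F i a) μ := by
  have hn : ∀ i, ‖(hF i).toL1 (F i)‖ = ∫ a, ‖F i a‖ ∂μ := fun i => L1.norm_of_fun_eq_integral_norm _
  have ht : ∑' i, ‖(hF i).toL1 (F i)‖ₑ ≠ ⊤ := by
    refine tsum_enorm_ne_top_iff_summable_norm.2 ?_
    simpa only [hn] using hs
  have h1 := Lp.coeFn_tsum ht
  refine (L1.integrable_coeFn (∑' i, (hF i).toL1 (F i))).congr ?_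
  have h2 : ∀ᵐ a ∂μ, ∀ i, (hF i).toL1 (F i) a = F i a :=
    ae_all_iff.2 fun i => (hF i).coeFn_toL1
  filter_upwards [h1, h2] with a ha1 ha2
  rw [ha1]
  exact tsum_congr ha2

instance countable_primitivePair : Countable PrimitivePair := by
  unfold PrimitivePair; infer_instance

instance countable_heckeRep : Countable HeckeRep :=
  have : Countable (Matrix (Fin 2) (Fin 2) ℤ) := inferInstanceAs (Countable (Fin 2 → Fin 2 → ℤ))
  Subtype.countable

/-- The term of index `(p, α)` of the product of the kernel and the Eisenstein function. -/
def kernelTerm (γ : Fin 2 → ℂ) (s : ℂ) (g : GL (Fin 2) ℝ) (x : PrimitivePair × HeckeRep)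
    (h : GL (Fin 2) ℝ) : ℂ :=
  ((|g.val.det| : ℝ) : ℂ) ^ (s + 1 / 2) *
    (((|h.val.det| : ℝ) : ℂ) ^ (s + 1 / 2) * (heckeGaussian g h x.2 : ℂ)) *
    eisensteinTerm γ h⁻¹ x.1

theorem tsum_kernelTerm {γ : Fin 2 → ℂ} (hγ : 1 < (γ 0 - γ 1).im) (s : ℂ) (g h : GL (Fin 2) ℝ) :
    ∑' x, kernelTerm γ s g x h = kernel s g h * eisenstein γ h⁻¹ := by
  have h1 := summable_eisensteinTerm hγ h⁻¹
  have h2 : Summable fun α : HeckeRep => ((|h.val.det| : ℝ) : ℂ) ^ (s + 1 / 2) *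
      (heckeGaussian g h α : ℂ) :=
    (Complex.hasSum_ofReal.2 (summable_heckeGaussian g h).hasSum).summable.mul_left _
  have h3 := tsum_mul_tsum_of_summable_norm h1.norm h2.norm
  have e : ∀ x : PrimitivePair × HeckeRep, kernelTerm γ s g x h =
      ((|g.val.det| : ℝ) : ℂ) ^ (s + 1 / 2) * (eisensteinTerm γ h⁻¹ x.1 *
        (((|h.val.det| : ℝ) : ℂ) ^ (s + 1 / 2) * (heckeGaussian g h x.2 : ℂ))) := by
    intro x
    unfold kernelTerm
    ring
  rw [tsum_congr e, tsum_mul_left, ← h3, kernel, eisenstein_eq_tsum]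
  ring

/-- Makes the right translation by αg explicit. The factor |det α|^{-(s+1/2)} compensates for the
determinant of α contained in K(hαg), while that of g is already present in the kernel. -/
theorem kernelTerm_eq (γ : Fin 2 → ℂ) (s : ℂ) (g : GL (Fin 2) ℝ) (x : PrimitivePair × HeckeRep)
    (h : GL (Fin 2) ℝ) :
    kernelTerm γ s g x h = ((|x.2.toGL.val.det| : ℝ) : ℂ) ^ (-(s + 1 / 2)) *
      (fun h' => localKernel s h' * sphericalFun γ
        (Matrix.SpecialLinearGroup.mapGL ℝ (primitiveMatrix x.1) * (x.2.toGL * g) * h'⁻¹))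
      (h * (x.2.toGL * g)) := by
  set y := x.2.toGL with hy
  have hd : (0 : ℝ) < |y.val.det| := abs_pos.2 (det_ne_zero y)
  have hdc : ((|y.val.det| : ℝ) : ℂ) ≠ 0 := by exact_mod_cast hd.ne'
  have hdet : |(h * (y * g)).val.det| = |h.val.det| * (|y.val.det| * |g.val.det|) := by
    rw [Matrix.GeneralLinearGroup.coe_mul, Matrix.det_mul, Matrix.GeneralLinearGroup.coe_mul,
      Matrix.det_mul, abs_mul, abs_mul]
  have hinv : Matrix.SpecialLinearGroup.mapGL ℝ (primitiveMatrix x.1) * (y * g) *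
      (h * (y * g))⁻¹ = Matrix.SpecialLinearGroup.mapGL ℝ (primitiveMatrix x.1) * h⁻¹ := by
    group
  have hpow : ((|y.val.det| : ℝ) : ℂ) ^ (-(s + 1 / 2)) * ((|y.val.det| : ℝ) : ℂ) ^ (s + 1 / 2)
      = 1 := by
    rw [← Complex.cpow_add _ _ hdc, neg_add_cancel, Complex.cpow_zero]
  simp only
  rw [hinv, kernelTerm, eisensteinTerm_eq_sphericalFun, heckeGaussian_eq_gaussian, localKernel,
    hdet, Complex.ofReal_mul, Complex.mul_cpow_ofReal_nonneg (abs_nonneg _) (by positivity),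
    Complex.ofReal_mul, Complex.mul_cpow_ofReal_nonneg (abs_nonneg _) (abs_nonneg _), ← hy]
  linear_combination (-((|g.val.det| : ℝ) : ℂ) ^ (s + 1 / 2) *
    (((|h.val.det| : ℝ) : ℂ) ^ (s + 1 / 2) * (gaussian (entries (h * (y * g))) : ℂ)) *
    sphericalFun γ (Matrix.SpecialLinearGroup.mapGL ℝ (primitiveMatrix x.1) * h⁻¹)) * hpow

theorem integrable_and_integral_kernelTerm {γ : Fin 2 → ℂ} {s : ℂ}
    (hs : ∀ j, 1 < (s - Complex.I * γ j).re) (g : GL (Fin 2) ℝ) (x : PrimitivePair × HeckeRep) :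
    Integrable (kernelTerm γ s g x) haarGL ∧
    ∫ h, kernelTerm γ s g x h ∂haarGL =
      Complex.Gammaℝ (s - Complex.I * γ 0) * Complex.Gammaℝ (s - Complex.I * γ 1) *
        heckeTerm γ s g x := by
  obtain ⟨i, e⟩ := integrable_and_integral_localKernel hs
    (Matrix.SpecialLinearGroup.mapGL ℝ (primitiveMatrix x.1) * (x.2.toGL * g))
  rw [funext (kernelTerm_eq γ s g x)]
  refine ⟨((integrable_mul_right_iff _ _).2 i).const_mul _, ?_⟩
  rw [integral_const_mul, integral_mul_right (fun h' => localKernel s h' * sphericalFun γ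
    (Matrix.SpecialLinearGroup.mapGL ℝ (primitiveMatrix x.1) * (x.2.toGL * g) * h'⁻¹)), e,
    heckeTerm, eisensteinTerm_eq_sphericalFun]
  ring

/-- The parameters `γ` whose characters are the absolute values of those of `γ`. -/
def absParam (γ : Fin 2 → ℂ) (j : Fin 2) : ℂ := -Complex.I * ((Complex.I * γ j).re : ℂ)

theorem I_mul_absParam (γ : Fin 2 → ℂ) (j : Fin 2) :
    Complex.I * absParam γ j = ((Complex.I * γ j).re : ℂ) := by
  rw [absParam, ← mul_assoc, mul_neg, Complex.I_mul_I, neg_neg, one_mul]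

theorem ofReal_norm_ofReal_cpow {x : ℝ} (hx : 0 < x) (b : ℂ) :
    ((‖(x : ℂ) ^ b‖ : ℝ) : ℂ) = (x : ℂ) ^ (b.re : ℂ) := by
  rw [Complex.norm_cpow_eq_rpow_re_of_pos hx, Complex.ofReal_cpow hx.le]

theorem ofReal_norm_eisensteinTerm (γ : Fin 2 → ℂ) (g : GL (Fin 2) ℝ) (p : PrimitivePair) :
    ((‖eisensteinTerm γ g p‖ : ℝ) : ℂ) = eisensteinTerm (absParam γ) g p := by
  have e1 : Complex.I * absParam γ 1 + 1 / 2 = ((Complex.I * γ 1 + 1 / 2).re : ℂ) := by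
    rw [I_mul_absParam, Complex.add_re]
    push_cast
    norm_num
  have e2 : (Complex.I * (absParam γ 0 - absParam γ 1) - 1) / 2 =
      (((Complex.I * (γ 0 - γ 1) - 1) / 2).re : ℂ) := by
    rw [mul_sub, I_mul_absParam, I_mul_absParam]
    simp
    ring
  rw [eisensteinTerm_eq_rowForm, eisensteinTerm_eq_rowForm, e1, e2, norm_mul, Complex.ofReal_mul,
    ofReal_norm_ofReal_cpow (abs_pos.2 (det_ne_zero g)), ofReal_norm_ofReal_cpow (p.rowForm_pos g)]

theorem heckeGaussian_pos (g h : GL (Fin 2) ℝ) (α : HeckeRep) : 0 < heckeGaussian g h α :=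
  Real.exp_pos _

theorem ofReal_norm_kernelTerm (γ : Fin 2 → ℂ) (s : ℂ) (g : GL (Fin 2) ℝ)
    (x : PrimitivePair × HeckeRep) (h : GL (Fin 2) ℝ) :
    ((‖kernelTerm γ s g x h‖ : ℝ) : ℂ) = kernelTerm (absParam γ) s.re g x h := by
  have e : (s.re : ℂ) + 1 / 2 = ((s + 1 / 2).re : ℂ) := by
    rw [Complex.add_re]
    push_cast
    norm_num
  rw [kernelTerm, kernelTerm, norm_mul, norm_mul, norm_mul, Complex.ofReal_mul, Complex.ofReal_mul,
    Complex.ofReal_mul, ofReal_norm_eisensteinTerm,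
    ofReal_norm_ofReal_cpow (abs_pos.2 (det_ne_zero g)),
    ofReal_norm_ofReal_cpow (abs_pos.2 (det_ne_zero h)), e, Complex.norm_real,
    Real.norm_of_nonneg (heckeGaussian_pos g h x.2).le]

/-- The norm of a term is the term for `absParam γ` and Re s, which satisfy the same inequalities.
Its integral is therefore given by the local formula, and the sum of these integrals is the Hecke
series already shown to converge. -/
theorem summable_integral_norm_kernelTerm {γ : Fin 2 → ℂ} {s : ℂ} (hγ : 1 < (γ 0 - γ 1).im)
    (hs : ∀ j, 1 < (s - Complex.I * γ j).re) (g : GL (Fin 2) ℝ) :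
    Summable fun x => ∫ h, ‖kernelTerm γ s g x h‖ ∂haarGL := by
  have hγ' : 1 < (absParam γ 0 - absParam γ 1).im := by
    simpa [absParam] using hγ
  have hs' : ∀ j, 1 < ((s.re : ℂ) - Complex.I * absParam γ j).re := by
    intro j
    rw [I_mul_absParam]
    simpa using hs j
  have h := ((hasSum_heckeTerm hγ' hs' g).summable.mul_left
    (Complex.Gammaℝ ((s.re : ℂ) - Complex.I * absParam γ 0) *
      Complex.Gammaℝ ((s.re : ℂ) - Complex.I * absParam γ 1)))
  rw [← Complex.summable_ofReal]
  refine h.congr fun x => ?_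
  rw [← (integrable_and_integral_kernelTerm hs' g x).2, ← integral_complex_ofReal]
  simp_rw [← ofReal_norm_kernelTerm]

theorem completedZeta_eq (s : ℂ) (γ : Fin 2 → ℂ) :
    completedZeta s γ =
      Complex.Gammaℝ (s - Complex.I * γ 0) * Complex.Gammaℝ (s - Complex.I * γ 1) *
        (riemannZeta (s - Complex.I * γ 0) * riemannZeta (s - Complex.I * γ 1)) := by
  rw [completedZeta, Fin.prod_univ_two, Complex.Gammaℝ_def, Complex.Gammaℝ_def]
  ring

theorem integrable_kernel_mul_eisenstein {γ : Fin 2 → ℂ} {s : ℂ} (hγ : 1 < (γ 0 - γ 1).im)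
    (hs : ∀ j, 1 < (s - Complex.I * γ j).re) (g : GL (Fin 2) ℝ) :
    Integrable (fun h => kernel s g h * eisenstein γ h⁻¹) haarGL := by
  simp_rw [← tsum_kernelTerm hγ s g]
  exact integrable_tsum_of_summable_integral_norm
    (fun x => (integrable_and_integral_kernelTerm hs g x).1)
    (summable_integral_norm_kernelTerm hγ hs g)

theorem heckeBaxter_eisenstein {γ : Fin 2 → ℂ} {s : ℂ} (hγ : 1 < (γ 0 - γ 1).im)
    (hs : ∀ j, 1 < (s - Complex.I * γ j).re) (g : GL (Fin 2) ℝ) :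
    heckeBaxter s (eisenstein γ) g = completedZeta s γ * eisenstein γ g := by
  have h := hasSum_integral_of_summable_integral_norm
    (fun x => (integrable_and_integral_kernelTerm hs g x).1)
    (summable_integral_norm_kernelTerm hγ hs g)
  simp_rw [tsum_kernelTerm hγ s g, fun x => (integrable_and_integral_kernelTerm hs g x).2] at h
  have h' := (hasSum_heckeTerm hγ hs g).mul_left
    (Complex.Gammaℝ (s - Complex.I * γ 0) * Complex.Gammaℝ (s - Complex.I * γ 1))
  rw [heckeBaxter, h.unique h', completedZeta_eq]
  ring

end

end HeckeBaxter

theorem mainTheorem1 (γ : Fin 2 → ℂ) (s : ℂ) (hγ : 1 < (γ 0 - γ 1).im)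
    (hs : ∀ j, 1 < (s - Complex.I * γ j).re) :
    (∀ g : GL (Fin 2) ℝ,
      HasSum (HeckeBaxter.eisensteinTerm γ g) (HeckeBaxter.eisenstein γ g)) ∧
    (∀ g h : GL (Fin 2) ℝ, Summable (HeckeBaxter.heckeGaussian g h)) ∧
    (∀ g : GL (Fin 2) ℝ,
      MeasureTheory.Integrable
        (fun h => HeckeBaxter.kernel s g h * HeckeBaxter.eisenstein γ h⁻¹) HeckeBaxter.haarGL) ∧
    ∀ g : GL (Fin 2) ℝ,
      HeckeBaxter.heckeBaxter s (HeckeBaxter.eisenstein γ) g =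
        HeckeBaxter.completedZeta s γ * HeckeBaxter.eisenstein γ g :=
  ⟨fun g => by
      rw [HeckeBaxter.eisenstein_eq_tsum]
      exact (HeckeBaxter.summable_eisensteinTerm hγ g).hasSum,
    HeckeBaxter.summable_heckeGaussian,
    HeckeBaxter.integrable_kernel_mul_eisenstein hγ hs,
    HeckeBaxter.heckeBaxter_eisenstein hγ hs⟩
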